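/- **Setting.** Let $U$ be a real Hilbert space, $\rho$ a probability measure on a measurable space $\Gamma$ (for instance a Borel subset of $\mathbb R^l$), and $g:U\times\Gamma\to\mathbb R$ a cost such that $g(\cdot,y)$ is $C^1$ for every $y$, $g(u,\cdot)$ is $\rho$-integrable and $\nabla g(u,\cdot)\in L^2_\rho(\Gamma;U)$ for every $u$, where $\nabla$ is the gradient in $u$. Let $J(u)=\mathbb E_{Y\sim\rho}[g(u,Y)]$. Assume that * $J$ is $\alpha$-strongly convex for some $\alpha>0$: $J(u)\ge J(u')+\langle\nabla J(u'),u-u'\rangle_U+\frac\alpha2\|u-u'\|_U^2$ for all $u,u'\in U$; * $\|\nabla g(u,y)-\nabla g(u',y)\|_U\le \ell(y)\|u-u'\|_U$ for all $u,u',y$, with $L:=\mathbb E_{Y\sim\rho}[\ell(Y)^2]^{1/2}<\infty$. Let $u^*$ be the minimizer of $J$. **Least squares.** Let $\varphi_1,\varphi_2,\dots:\Gamma\to U$ be strongly measurable, $m_0\le m_1\le\cdots$, and for each $p$ let $\varphi_1,\dots,\varphi_{m_p}$ be orthonormal in $L^2_\rho(\Gamma;U)$ with span $\mathbb V_{m_p}$,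 such that for every $y\in\Gamma$ some $v\in\mathbb V_{m_p}$ has $v(y)\ne0$. For a weight $w\ge 0$ on $\Gamma$ and data $\mathcal S=\{(y_i,d_i)\}_{i=1}^s\subset\Gamma\times U$, let $G_{ij}=\frac1s\sum_{l=1}^s w(y_l)\langle\varphi_i(y_l),\varphi_j(y_l)\rangle_U$, and let $\tilde\Pi^{\mathbb V_m}_{\mathcal S}$ be the minimizer over $v\in\mathbb V_m$ of $\frac1s\sum_l w(y_l)\|v(y_l)-d_l\|_U^2$ if $\|G-I\|_2\le\frac12$, and $0$ otherwise. **Algorithm (SG-LSCV).** Iterations are divided into phases: phase $p\ge0$ consists of the iterations $\sigma(p)\le k<\sigma(p+1)$, where $\sigma(0)=0$, $\sigma$ is nondecreasing and $\sigma(p)\to\infty$. Phase $p$ uses the space $\mathbb V_{m_p}$, a sampling measure $\mu_p$ with weight $w_p=d\rho/d\mu_p$, $\sup_\Gamma w_p<\infty$, and a memory of $\bar s_p\ge1$ data points, with $\bar s_{p+1}-\bar s_p\le\sigma(p+1)-\sigma(p)$. Either $\mu_p=\mu$ is a fixed probability measure with $\rho\ll\mu$ (and $w_p=w$ an everywhere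 defined version of $d\rho/d\mu$), or $\mu_p$ is the optimal measure $d\mu_p=\frac1{m_p}\sum_{j\le m_p}\|\varphi_j\|_U^2\,d\rho$ with $w_p=m_p/\sum_{j\le m_p}\|\varphi_j\|_U^2$. The algorithm with a fixed approximation space is the case of constant $m_p$, $\bar s_p$ and $\mu_p=\mu$. For $k$ in phase $p$ write $m_k=m_p$, $s_k=\bar s_p$, $w_k=w_p$, $\mu_k=\mu_p$, $q_k=\sup_{y\in\Gamma}w_k(y)$; let $\tau_k\ge0$ be the step sizes. The initial memory points $Y_j\sim\mu_0$, $-\bar s_0\le j<0$, and the draws $Y_k\sim\mu_k$, $k\ge0$, are independent. The initial iterates $u_j$, $-\bar s_0\le j\le0$, are square integrable, and $u_j$ depends only on the $Y_i$ with $i<j$ and possibly on further randomness independent of all draws (e.g. they are deterministic). With the optimal measures, at the switch from phase $p$ to phase $p+1$ each of the memory points $Y_j$, $\sigma(p+1)-\bar s_{p+1}\le j<\sigma(p+1)$, is kept with probability $m_p/m_{p+1}$ and otherwise replaced by a draw from $\frac1{m_{p+1}-m_p}\sum_{m_p<j\le m_{p+1}}\|\varphi_j\|_U^2\,d\rho$,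 all these choices being independent of each other and of all the other randomness; the current value is again denoted $Y_j$. With $\mathcal S_k=\{(Y_j,\nabla g(u_j,Y_j))\}_{j=k-s_k}^{k-1}$ and $v_k=\tilde\Pi^{\mathbb V_{m_k}}_{\mathcal S_k}$ computed with weight $w_k$, the iterates are, for $k\ge0$, $$u_{k+1}=u_k-\tau_k\Big(w_k(Y_k)\big(\nabla g(u_k,Y_k)-v_k(Y_k)\big)+\int_\Gamma v_k\,d\rho\Big).$$ **Theorem.** Let $\mathcal S_k^*=\{(Y_j,\nabla g(u^*,Y_j))\}_{j=k-s_k}^{k-1}$ be the idealized memory. Then all iterates are square integrable, and for every $k\ge0$ (with all the expectations below finite) $$\mathbb E\|u_{k+1}-u^*\|_U^2\le(1-2\tau_k\alpha+4q_k\tau_k^2L^2)\,\mathbb E\|u_k-u^*\|_U^2+2q_k\tau_k^2\,\mathbb E\big\|\nabla g(u^*,Y)-\tilde\Pi^{\mathbb V_{m_k}}_{\mathcal S^*_k}(Y)\big\|_U^2+24\tau_k^2\frac{q_k}{s_k}\sum_{i=1}^{s_k}L^2\,\mathbb E\|u_{k-i}-u^*\|_U^2,$$ where in the second term $Y\sim\rho$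 is independent of the memory and the expectation is over both. -/

import Mathlib

open MeasureTheory ProbabilityTheory Filter
open scoped BigOperators RealInnerProductSpace

noncomputable section

namespace SGLSCV

/-! ### The stochastic optimization problem -/

section Problem

variable {U Γ : Type*} [NormedAddCommGroup U] [InnerProductSpace ℝ U] [CompleteSpace U]
  [MeasurableSpace Γ]

/-- The partial gradient `∇g(u, y)` of the cost `g` with respect to the design `u`. -/
def gradCost (g : U → Γ → ℝ) (u : U) (y : Γ) : U := gradient (fun v => g v y) u

/-- The objective `J(u) = E_{Y ∼ ρ}[g(u, Y)]`. -/
def objective (ρ : Measure Γ) (g : U → Γ → ℝ) (u : U) : ℝ := ∫ y, g u y ∂ρ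

/-- Standing conventions on the cost: `g(·, y)` is `C¹`, the objective is well defined, and
`∇g(u, ·)` belongs to `L²_ρ(Γ; U)` (a space of strongly measurable functions). -/
structure IsCost (ρ : Measure Γ) (g : U → Γ → ℝ) : Prop where
  contDiff : ∀ y, ContDiff ℝ 1 (fun u => g u y)
  integrable : ∀ u, Integrable (g u) ρ
  grad_measurable : ∀ u, StronglyMeasurable (gradCost g u)
  grad_memLp : ∀ u, MemLp (gradCost g u) 2 ρ

/-- `J` is `α`-strongly convex with `α > 0`. -/
def StronglyConvex (J : U → ℝ) (α : ℝ) : Prop :=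
  0 < α ∧ ∀ u u' : U,
    J u ≥ J u' + ⟪gradient J u', u - u'⟫ + α / 2 * ‖u - u'‖ ^ 2

/-- `g(·, y)` has an `ℓ(y)`-Lipschitz gradient, with `ℓ` square integrable. -/
structure LipschitzGradient (ρ : Measure Γ) (g : U → Γ → ℝ) (ℓ : Γ → ℝ) : Prop where
  lip : ∀ y u u', ‖gradCost g u y - gradCost g u' y‖ ≤ ℓ y * ‖u - u'‖
  memLp : MemLp ℓ 2 ρ

/-- `L = E_{Y ∼ ρ}[ℓ(Y)²]^{1/2}`. -/
def lipConst (ρ : Measure Γ) (ℓ : Γ → ℝ) : ℝ := Real.sqrt (∫ y, ℓ y ^ 2 ∂ρ)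

end Problem

/-! ### Approximation spaces and conditioned weighted least squares -/

section LeastSquares

variable {U Γ : Type*} [NormedAddCommGroup U] [InnerProductSpace ℝ U]

/-- The space `𝕍_m` spanned by the first `m` functions `φ₀, …, φ_{m-1} : Γ → U`. -/
def approxSpace (φ : ℕ → Γ → U) (m : ℕ) : Submodule ℝ (Γ → U) :=
  Submodule.span ℝ (φ '' Set.Iio m)

/-- `φ₀, …, φ_{m-1}` is an orthonormal basis in `L²_ρ(Γ; U)` of `approxSpace φ m`, and no point of
`Γ` is a common zero of that space. -/
structure IsApproxBasis [MeasurableSpace Γ] (ρ : Measure Γ) (φ : ℕ → Γ → U) (m : ℕ) : Prop where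
  measurable : ∀ j < m, StronglyMeasurable (φ j)
  memLp : ∀ j < m, MemLp (φ j) 2 ρ
  orthonormal : ∀ i < m, ∀ j < m, ∫ y, ⟪φ i y, φ j y⟫ ∂ρ = if i = j then 1 else 0
  nonvanishing : ∀ y, ∃ v ∈ approxSpace φ m, v y ≠ 0

/-- The empirical Gram matrix
`G_{ij} = (1/s) ∑_l w(y_l) ⟨φ_i(y_l), φ_j(y_l)⟩` of the sample `y₁, …, y_s`. -/
def gram (φ : ℕ → Γ → U) (m : ℕ) (w : Γ → ℝ) {s : ℕ} (y : Fin s → Γ) :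
    Matrix (Fin m) (Fin m) ℝ :=
  fun i j => (1 / (s : ℝ)) * ∑ l, w (y l) * ⟪φ i (y l), φ j (y l)⟫

/-- The spectral norm of a real square matrix. -/
def spectralNorm {m : ℕ} (A : Matrix (Fin m) (Fin m) ℝ) : ℝ :=
  ‖Matrix.toEuclideanCLM (n := Fin m) (𝕜 := ℝ) A‖

/-- The weighted least-squares loss `(1/s) ∑_l w(y_l) ‖v(y_l) - d_l‖²`. -/
def lsLoss (w : Γ → ℝ) {s : ℕ} (y : Fin s → Γ) (d : Fin s → U) (v : Γ → U) : ℝ :=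
  (1 / (s : ℝ)) * ∑ l, w (y l) * ‖v (y l) - d l‖ ^ 2

/-- The weighted least-squares estimator: a minimizer over `𝕍_m` of the loss with points `y_l` and
observations `d_l` (the minimizer is unique as soon as the Gram matrix is invertible). -/
def leastSquares (φ : ℕ → Γ → U) (m : ℕ) (w : Γ → ℝ) {s : ℕ} (y : Fin s → Γ) (d : Fin s → U) :
    Γ → U :=
  Classical.epsilon fun v => v ∈ approxSpace φ m ∧
    ∀ v' ∈ approxSpace φ m, lsLoss w y d v ≤ lsLoss w y d v'

open Classical in
/-- The conditioned estimator: least squares if `‖G - I‖₂ ≤ 1/2`, and `0` otherwise. -/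
def condLeastSquares (φ : ℕ → Γ → U) (m : ℕ) (w : Γ → ℝ) {s : ℕ} (y : Fin s → Γ)
    (d : Fin s → U) : Γ → U :=
  if spectralNorm (gram φ m w y - 1) ≤ 1 / 2 then leastSquares φ m w y d else 0

end LeastSquares

/-! ### Sampling measures and resampling -/

section Sampling

variable {U Γ : Type*} [NormedAddCommGroup U] [MeasurableSpace Γ]

/-- For each phase `p`: the sampling measure `μ_p`, the weight `w_p = dρ/dμ_p`, the probability
`keep p` that a memory point is kept at the switch from phase `p` to phase `p + 1`, and the law
`redrawLaw p` from which it is redrawn otherwise. -/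
structure SamplingScheme (Γ : Type*) [MeasurableSpace Γ] where
  μ : ℕ → Measure Γ
  w : ℕ → Γ → ℝ
  keep : ℕ → ℝ
  redrawLaw : ℕ → Measure Γ

/-- One sampling measure for all phases: every memory point is kept at every switch. -/
def fixedSampling (μ : Measure Γ) (w : Γ → ℝ) : SamplingScheme Γ where
  μ _ := μ
  w _ := w
  keep _ := 1
  redrawLaw _ := μ

/-- The optimal sampling measures `dμ_p = (1/m_p) ∑_{j < m_p} ‖φ_j‖² dρ`, for which
`w_p = m_p / ∑_{j < m_p} ‖φ_j‖²`. At the switch from `p` to `p + 1` a point is kept with probability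
`m_p / m_{p+1}` and otherwise redrawn from
`(1/(m_{p+1} - m_p)) ∑_{m_p ≤ j < m_{p+1}} ‖φ_j‖² dρ`. -/
def optimalSampling (ρ : Measure Γ) (φ : ℕ → Γ → U) (m : ℕ → ℕ) : SamplingScheme Γ where
  μ p := ρ.withDensity fun y =>
    ENNReal.ofReal ((1 / (m p : ℝ)) * ∑ j ∈ Finset.range (m p), ‖φ j y‖ ^ 2)
  w p y := (m p : ℝ) / ∑ j ∈ Finset.range (m p), ‖φ j y‖ ^ 2
  keep p := (m p : ℝ) / (m (p + 1) : ℝ)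
  redrawLaw p := ρ.withDensity fun y =>
    ENNReal.ofReal ((1 / ((m (p + 1) : ℝ) - (m p : ℝ))) *
      ∑ j ∈ Finset.Ico (m p) (m (p + 1)), ‖φ j y‖ ^ 2)

/-- Either one fixed probability measure `μ` with `ρ ≪ μ` and (an everywhere defined version of)
`w = dρ/dμ`, or the optimal sampling measures with resampling. -/
def SamplingScheme.IsAdmissible (S : SamplingScheme Γ) (ρ : Measure Γ) (φ : ℕ → Γ → U)
    (m : ℕ → ℕ) : Prop :=
  (∃ (μ : Measure Γ) (w : Γ → ℝ), IsProbabilityMeasure μ ∧ Measurable w ∧ (∀ y, 0 ≤ w y) ∧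
    ρ = μ.withDensity (fun y => ENNReal.ofReal (w y)) ∧ S = fixedSampling μ w) ∨
  S = optimalSampling ρ φ m

end Sampling

/-! ### The algorithm -/

section Algorithm

/-- The inputs of the algorithm. Phase `p` consists of the iterations `σ p ≤ k < σ (p + 1)`; it uses
the space `approxSpace φ (m p)` and a memory of `s p` data points. The step sizes are `τ k`.
The algorithm with a fixed approximation space is the case of constant `m` and `s` together with
`fixedSampling`. -/
structure Params (U Γ : Type*) [MeasurableSpace Γ] where
  φ : ℕ → Γ → U
  m : ℕ → ℕ
  S : SamplingScheme Γ
  σ : ℕ → ℕ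
  s : ℕ → ℕ
  τ : ℕ → ℝ

variable {U Γ Ω : Type*} [NormedAddCommGroup U] [InnerProductSpace ℝ U] [CompleteSpace U]
  [MeasurableSpace Γ]

/-- The phase of iteration `k`, i.e. the generalized inverse `inf {p : σ(p+1) > k}`. -/
def Params.phase (A : Params U Γ) (k : ℕ) : ℕ := sInf {p | k < A.σ (p + 1)}

/-- `m_k`, the dimension used at iteration `k`. -/
def Params.dim (A : Params U Γ) (k : ℕ) : ℕ := A.m (A.phase k)

/-- `s_k`, the memory size at iteration `k`. -/
def Params.size (A : Params U Γ) (k : ℕ) : ℕ := A.s (A.phase k)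

/-- `w_k`, the weight at iteration `k`. -/
def Params.weight (A : Params U Γ) (k : ℕ) : Γ → ℝ := A.S.w (A.phase k)

/-- `q_k = sup_{y ∈ Γ} w_k(y)`. -/
def Params.q (A : Params U Γ) (k : ℕ) : ℝ := ⨆ y, A.weight k y

/-- Admissible inputs. The last field says that a phase is long enough for the memory to grow to
its next size by at most one new data point per iteration. -/
structure Params.IsAdmissible (A : Params U Γ) (ρ : Measure Γ) : Prop where
  basis : ∀ p, IsApproxBasis ρ A.φ (A.m p)
  nested : Monotone A.m
  sampling : A.S.IsAdmissible ρ A.φ A.m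
  weight_bdd : ∀ p, BddAbove (Set.range (A.S.w p))
  step_nonneg : ∀ k, 0 ≤ A.τ k
  sched_zero : A.σ 0 = 0
  sched_mono : Monotone A.σ
  sched_tendsto : Tendsto A.σ atTop atTop
  size_pos : ∀ p, 0 < A.s p
  size_growth : ∀ p, A.s (p + 1) + A.σ p ≤ A.s p + A.σ (p + 1)

/-- All the draws. `Y j` is the draw of iteration `j` (for `j < 0`: a point of the initial memory).
At the switch from phase `p` to `p + 1`, `coin p j` decides whether data point `j` is kept (`true`)
or replaced by `redraw p j`. -/
structure Draws (Ω Γ : Type*) where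
  Y : ℤ → Ω → Γ
  coin : ℕ → ℤ → Ω → Bool
  redraw : ℕ → ℤ → Ω → Γ

/-- Labels of the independent sources of randomness. -/
inductive Source where
  | init : Source
  | draw : ℤ → Source
  | coin : ℕ → ℤ → Source
  | redraw : ℕ → ℤ → Source

/-- The `σ`-algebra of each source; `𝓐` carries any randomness used to choose the initial
iterates. -/
@[reducible]
def Draws.sigma (D : Draws Ω Γ) (𝓐 : MeasurableSpace Ω) : Source → MeasurableSpace Ω
  | Source.init => 𝓐
  | Source.draw j => MeasurableSpace.comap (D.Y j) inferInstance
  | Source.coin p j => MeasurableSpace.comap (D.coin p j) inferInstance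
  | Source.redraw p j => MeasurableSpace.comap (D.redraw p j) inferInstance

/-- The draws are mutually independent and have the prescribed laws. -/
structure Draws.IsSample (D : Draws Ω Γ) (𝓐 : MeasurableSpace Ω) [mΩ : MeasurableSpace Ω]
    (P : Measure Ω) (A : Params U Γ) : Prop where
  init_le : 𝓐 ≤ mΩ
  measurable_Y : ∀ j, Measurable (D.Y j)
  measurable_coin : ∀ p j, Measurable (D.coin p j)
  measurable_redraw : ∀ p j, Measurable (D.redraw p j)
  indep : iIndep (D.sigma 𝓐) P
  law_init : ∀ j : ℤ, -(A.s 0 : ℤ) ≤ j → j < 0 → P.map (D.Y j) = A.S.μ 0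
  law_Y : ∀ k : ℕ, P.map (D.Y k) = A.S.μ (A.phase k)
  law_coin : ∀ p j, P (D.coin p j ⁻¹' {true}) = ENNReal.ofReal (A.S.keep p)
  law_redraw : ∀ p j, A.S.keep p < 1 → P.map (D.redraw p j) = A.S.redrawLaw p

/-- The current value of data point `j` in phase `p`: at the switch to phase `p + 1`, the points
`σ(p+1) - s_{p+1} ≤ j < σ(p+1)` of the (extended) memory whose coin shows `false` are redrawn. -/
def Draws.point (D : Draws Ω Γ) (A : Params U Γ) : ℕ → ℤ → Ω → Γ
  | 0, j, ω => D.Y j ω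
  | p + 1, j, ω =>
    if ((A.σ (p + 1) : ℤ) - A.s (p + 1) ≤ j ∧ j < A.σ (p + 1)) ∧ D.coin p j ω = false
    then D.redraw p j ω
    else D.point A p j ω

/-- The points of the memory at iteration `k`, i.e. the current values of the data points
`k - 1, …, k - s_k`. -/
def Draws.memory (D : Draws Ω Γ) (A : Params U Γ) (k : ℕ) (ω : Ω) : Fin (A.size k) → Γ :=
  fun l => D.point A (A.phase k) ((k : ℤ) - ((l : ℤ) + 1)) ω

/-- The control variate `Π̃_{𝒮_k}[∇g]` built at iteration `k` from the memory
`𝒮_k = {(Y_j, ∇g(u_j, Y_j))}`, `k - s_k ≤ j ≤ k - 1`. -/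
def controlVariate (g : U → Γ → ℝ) (A : Params U Γ) (D : Draws Ω Γ) (u : ℤ → Ω → U) (k : ℕ)
    (ω : Ω) : Γ → U :=
  condLeastSquares A.φ (A.dim k) (A.weight k) (D.memory A k ω)
    fun l => gradCost g (u ((k : ℤ) - ((l : ℤ) + 1)) ω) (D.memory A k ω l)

/-- The estimator `Π̃_{𝒮*_k}[∇g]` built from the idealized memory
`𝒮*_k = {(Y_j, ∇g(u*, Y_j))}`, `k - s_k ≤ j ≤ k - 1`. -/
def idealVariate (g : U → Γ → ℝ) (A : Params U Γ) (D : Draws Ω Γ) (ustar : U) (k : ℕ)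
    (ω : Ω) : Γ → U :=
  condLeastSquares A.φ (A.dim k) (A.weight k) (D.memory A k ω)
    fun l => gradCost g ustar (D.memory A k ω l)

/-- `u` is the sequence of iterates. The initial iterates `u_{-s_0}, …, u_0` are square integrable
and non-anticipating (in particular they may be deterministic, or come from `s_0` steps of a
stochastic gradient method using the points of the initial memory). The expectation
`E_{Y ∼ ρ}[v_k(Y) | 𝓕_k]` of the control variate `v_k`, which is determined by the past, is the
integral of `v_k` with respect to `ρ`. -/
structure IsIterates (ρ : Measure Γ) (g : U → Γ → ℝ) (A : Params U Γ) (𝓐 : MeasurableSpace Ω)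
    [MeasurableSpace Ω] (P : Measure Ω) (D : Draws Ω Γ) (u : ℤ → Ω → U) : Prop where
  init_adapted : ∀ j : ℤ, -(A.s 0 : ℤ) ≤ j → j ≤ 0 →
    StronglyMeasurable[𝓐 ⊔ ⨆ i ∈ Set.Ico (-(A.s 0 : ℤ)) j, D.sigma 𝓐 (Source.draw i)] (u j)
  init_memLp : ∀ j : ℤ, -(A.s 0 : ℤ) ≤ j → j ≤ 0 → MemLp (u j) 2 P
  step : ∀ (k : ℕ) (ω : Ω),
    u ((k : ℤ) + 1) ω = u k ω - A.τ k •
      (A.weight k (D.Y k ω) •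
          (gradCost g (u k ω) (D.Y k ω) - controlVariate g A D u k ω (D.Y k ω))
        + ∫ y, controlVariate g A D u k ω y ∂ρ)

end Algorithm

end SGLSCV

end

/-!
For a frozen past the search direction of iteration `k` is
`X = w (∇g(u_k, Y) - v) + ∫ v dρ` with `Y ∼ μ_k`, and since `w = dρ/dμ_k` its mean is `∇J(u_k)`.
Strong convexity bounds the cross term `⟨∇J(u_k), u_k - u*⟩` from below by `α ‖u_k - u*‖²`. For the
second moment, let `v*` be the control variate built from the idealized memory and write
`X = A - B + C` with
`A = w (∇g(u_k, ·) - ∇g(u*, ·))`, `B = w (v - v*) - ∫ (v - v*) dρ` and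
`C = w (∇g(u*, ·) - v*) - ∫ (∇g(u*, ·) - v*) dρ`, using `∫ ∇g(u*, ·) dρ = ∇J(u*) = 0`. Then
`‖X‖² ≤ 4 ‖A‖² + 4 ‖B‖² + 2 ‖C‖²`, centering only decreases second moments, and `w ≤ q_k` turns
second moments under `μ_k` into `q_k` times second moments under `ρ` (`IsWeight.step_le`).

The term `A` is handled by the Lipschitz bound and `C` is the approximation error. For `B`, the
estimator is linear in the data, and when `‖G - I‖ ≤ 1/2` the squared norm of its coefficients is at
most twice the weighted mean square of the data (`lsCoef_sub`, `sum_sq_lsCoef_le`). Hence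
`‖v - v*‖²` is at most `2/s_k` times the sum over the memory of
`w(Y_j) ‖∇g(u_j, Y_j) - ∇g(u*, Y_j)‖²`. The expectation of each summand is at most
`L² E‖u_j - u*‖²`, because `Y_j` has law `μ_k` and is independent of `u_j`.

These two facts survive resampling. The law is preserved because `μ_{p+1}` is the mixture of `μ_p`
and the redraw law with weights given by the coin (`Draws.IsSample.map_point`). For independence, the
sources of randomness are sorted by the index of the data point they act on rather than by time:
`u_j` is measurable with respect to the sources of index smaller than `j`, while the value of data
point `j` in any phase is a function of sources of index `j` only
(`Draws.IsSample.indep_past_point`). Conditional expectations are replaced by integrating out the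
independent variable first (`integrable_and_integral_le_of_indep`), which also yields the
integrability of each new iterate.
-/

noncomputable section

namespace SGLSCV

/-! ### The gradient of the objective -/

theorem _root_.MeasureTheory.MemLp.integrable_sq_norm {X E : Type*} [MeasurableSpace X]
    [NormedAddCommGroup E] {μ : Measure X} {f : X → E} (hf : MemLp f 2 μ) :
    Integrable (fun x => ‖f x‖ ^ 2) μ :=
  (memLp_two_iff_integrable_sq_norm hf.1).1 hf

section Objective

variable {U Γ : Type*} [NormedAddCommGroup U] [InnerProductSpace ℝ U] [CompleteSpace U]
  [MeasurableSpace Γ] {ρ : Measure Γ} {g : U → Γ → ℝ} {ℓ : Γ → ℝ} {α : ℝ}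

theorem IsCost.hasGradientAt (hg : IsCost ρ g) (u : U) (y : Γ) :
    HasGradientAt (fun v => g v y) (gradCost g u y) u :=
  (((hg.contDiff y).differentiable one_ne_zero) u).hasGradientAt

theorem LipschitzGradient.continuous_gradCost (hℓ : LipschitzGradient ρ g ℓ) (y : Γ) :
    Continuous fun u => gradCost g u y := by
  refine (LipschitzWith.of_dist_le_mul (K := Real.toNNReal (ℓ y)) fun u v => ?_).continuous
  rw [dist_eq_norm, dist_eq_norm]
  exact (hℓ.lip y u v).trans
    (mul_le_mul_of_nonneg_right (Real.le_coe_toNNReal _) (norm_nonneg _))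

/-- Differentiation under the integral sign: near `u` the gradient of the cost is dominated by
`‖∇g(u, ·)‖ + |ℓ|`. -/
theorem hasGradientAt_objective [IsProbabilityMeasure ρ] (hg : IsCost ρ g)
    (hℓ : LipschitzGradient ρ g ℓ) (u : U) :
    HasGradientAt (objective ρ g) (∫ y, gradCost g u y ∂ρ) u := by
  have hdom := hasFDerivAt_integral_of_dominated_of_fderiv_le (μ := ρ) (𝕜 := ℝ)
    (F := g) (F' := fun v y => InnerProductSpace.toDual ℝ U (gradCost g v y))
    (bound := fun y => ‖gradCost g u y‖ + |ℓ y|)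
    (x₀ := u) (Metric.ball_mem_nhds u one_pos)
    (Eventually.of_forall fun v => (hg.integrable v).aestronglyMeasurable)
    (hg.integrable u)
    ((InnerProductSpace.toDual ℝ U).continuous.comp_aestronglyMeasurable
      (hg.grad_measurable u).aestronglyMeasurable)
    (Eventually.of_forall fun y v hv => ?_)
    (((hg.grad_memLp u).integrable one_le_two).norm.add (hℓ.memLp.integrable one_le_two).abs)
    (Eventually.of_forall fun y v _ => hasGradientAt_iff_hasFDerivAt.1 (hg.hasGradientAt v y))
  · rw [hasGradientAt_iff_hasFDerivAt]
    have h2 : InnerProductSpace.toDual ℝ U (∫ y, gradCost g u y ∂ρ)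
        = ∫ y, InnerProductSpace.toDual ℝ U (gradCost g u y) ∂ρ :=
      ((InnerProductSpace.toDual ℝ U).toContinuousLinearEquiv.toContinuousLinearMap.integral_comp_comm
        ((hg.grad_memLp u).integrable one_le_two)).symm
    rw [h2]
    exact hdom
  · rw [LinearIsometryEquiv.norm_map]
    have h1 := hℓ.lip y v u
    have h2 : ‖gradCost g v y‖ ≤ ‖gradCost g u y‖ + ‖gradCost g v y - gradCost g u y‖ := by
      have := norm_add_le (gradCost g u y) (gradCost g v y - gradCost g u y)
      rwa [add_sub_cancel] at this
    have h3 : ‖v - u‖ ≤ 1 := by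
      rw [← dist_eq_norm]; exact (Metric.mem_ball.1 hv).le
    have h4 : ℓ y * ‖v - u‖ ≤ |ℓ y| * 1 :=
      mul_le_mul (le_abs_self _) h3 (norm_nonneg _) (abs_nonneg _)
    linarith

theorem integral_gradCost_minimizer [IsProbabilityMeasure ρ] (hg : IsCost ρ g)
    (hℓ : LipschitzGradient ρ g ℓ) {ustar : U}
    (hustar : ∀ u, objective ρ g ustar ≤ objective ρ g u) :
    ∫ y, gradCost g ustar y ∂ρ = 0 := by
  have h := (hasGradientAt_iff_hasFDerivAt.1 (hasGradientAt_objective hg hℓ ustar))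
  have h0 := IsLocalMin.hasFDerivAt_eq_zero (Eventually.of_forall hustar) h
  simpa using h0

/-- The gradient of a strongly convex objective is strongly monotone; here against the minimizer,
where the gradient vanishes. -/
theorem StronglyConvex.le_inner_integral_gradCost [IsProbabilityMeasure ρ]
    (hα : StronglyConvex (objective ρ g) α) (hg : IsCost ρ g)
    (hℓ : LipschitzGradient ρ g ℓ) {ustar : U}
    (hustar : ∀ u, objective ρ g ustar ≤ objective ρ g u) (u : U) :
    α * ‖u - ustar‖ ^ 2 ≤ ⟪u - ustar, ∫ y, gradCost g u y ∂ρ⟫ := by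
  have h1 := hα.2 u ustar
  have h2 := hα.2 ustar u
  rw [(hasGradientAt_objective hg hℓ _).gradient] at h1 h2
  rw [integral_gradCost_minimizer hg hℓ hustar, inner_zero_left] at h1
  rw [← neg_sub u ustar, inner_neg_right, norm_neg, real_inner_comm] at h2
  linarith

theorem LipschitzGradient.sq_norm_sub_le (hℓ : LipschitzGradient ρ g ℓ) (u v : U) (y : Γ) :
    ‖gradCost g u y - gradCost g v y‖ ^ 2 ≤ ℓ y ^ 2 * ‖u - v‖ ^ 2 := by
  rw [← mul_pow]
  exact pow_le_pow_left₀ (norm_nonneg _) (hℓ.lip y u v) 2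

theorem lipConst_sq : lipConst ρ ℓ ^ 2 = ∫ y, ℓ y ^ 2 ∂ρ :=
  Real.sq_sqrt (integral_nonneg fun _ => sq_nonneg _)

theorem LipschitzGradient.integral_sq_norm_sub_le (hg : IsCost ρ g)
    (hℓ : LipschitzGradient ρ g ℓ) (u v : U) :
    ∫ y, ‖gradCost g u y - gradCost g v y‖ ^ 2 ∂ρ ≤ lipConst ρ ℓ ^ 2 * ‖u - v‖ ^ 2 := by
  rw [lipConst_sq, ← integral_mul_const]
  exact integral_mono ((hg.grad_memLp u).sub (hg.grad_memLp v)).integrable_sq_norm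
    (hℓ.memLp.integrable_sq.mul_const _) fun y => hℓ.sq_norm_sub_le u v y

end Objective

/-! ### Importance sampling and one step for a frozen past -/

section Weighted

variable {U Γ : Type*} [NormedAddCommGroup U] [InnerProductSpace ℝ U]
  [MeasurableSpace Γ] {ρ μ : Measure Γ} {w : Γ → ℝ} {q : ℝ}

/-- Importance sampling: `w` is an everywhere defined version of `dρ/dμ` with values in `[0, q]`. -/
structure IsWeight (ρ μ : Measure Γ) (w : Γ → ℝ) (q : ℝ) : Prop where
  measurable : Measurable w
  nonneg : ∀ y, 0 ≤ w y
  le : ∀ y, w y ≤ q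
  eq : ρ = μ.withDensity fun y => ENNReal.ofReal (w y)

theorem IsWeight.integral_eq (h : IsWeight ρ μ w q) {E : Type*} [NormedAddCommGroup E]
    [NormedSpace ℝ E] (f : Γ → E) : ∫ y, f y ∂ρ = ∫ y, w y • f y ∂μ := by
  rw [h.eq, integral_withDensity_eq_integral_toReal_smul h.measurable.ennreal_ofReal
    (by simp)]
  simp only [ENNReal.toReal_ofReal (h.nonneg _)]

theorem IsWeight.integrable_iff (h : IsWeight ρ μ w q) {E : Type*} [NormedAddCommGroup E]
    [NormedSpace ℝ E] (f : Γ → E) : Integrable f ρ ↔ Integrable (fun y => w y • f y) μ := by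
  rw [h.eq, integrable_withDensity_iff_integrable_smul' h.measurable.ennreal_ofReal
    (by simp)]
  simp only [ENNReal.toReal_ofReal (h.nonneg _)]

/-- Boundedness of the weight turns an `L²_ρ` function into a square integrable importance sampling
estimator. -/
theorem IsWeight.memLp_smul (h : IsWeight ρ μ w q) {f : Γ → U} (hf : StronglyMeasurable f)
    (hf2 : MemLp f 2 ρ) : MemLp (fun y => w y • f y) 2 μ := by
  have hm : StronglyMeasurable fun y => w y • f y := h.measurable.stronglyMeasurable.smul hf
  rw [memLp_two_iff_integrable_sq_norm hm.aestronglyMeasurable]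
  have h1 := (h.integrable_iff _).1 hf2.integrable_sq_norm
  refine (h1.const_mul q).mono' (hm.norm.pow 2).aestronglyMeasurable
    (Eventually.of_forall fun y => ?_)
  have hw := h.nonneg y
  rw [Real.norm_of_nonneg (sq_nonneg _), norm_smul, Real.norm_of_nonneg hw, mul_pow, smul_eq_mul]
  have := mul_le_mul_of_nonneg_right (h.le y) (mul_nonneg hw (sq_nonneg ‖f y‖))
  calc w y ^ 2 * ‖f y‖ ^ 2 = w y * (w y * ‖f y‖ ^ 2) := by ring
    _ ≤ _ := this

theorem IsWeight.integral_sq_norm_smul_le (h : IsWeight ρ μ w q) {f : Γ → U}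
    (hf : StronglyMeasurable f) (hf2 : MemLp f 2 ρ) :
    ∫ y, ‖w y • f y‖ ^ 2 ∂μ ≤ q * ∫ y, ‖f y‖ ^ 2 ∂ρ := by
  rw [h.integral_eq, ← integral_const_mul]
  have h1 := (h.integrable_iff _).1 hf2.integrable_sq_norm
  refine integral_mono (h.memLp_smul hf hf2).integrable_sq_norm
    (by simpa using h1.const_mul q) fun y => ?_
  have hw := h.nonneg y
  have := mul_le_mul_of_nonneg_right (h.le y) (mul_nonneg hw (sq_nonneg ‖f y‖))
  simp only [norm_smul, Real.norm_eq_abs, abs_of_nonneg hw, mul_pow, smul_eq_mul]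
  calc w y ^ 2 * ‖f y‖ ^ 2 = w y * (w y * ‖f y‖ ^ 2) := by ring
    _ ≤ _ := this

/-- A variance is at most a second moment: recentring the importance sampling estimator of
`∫ f dρ` does not increase the bound on its second moment. -/
theorem IsWeight.integral_sq_norm_centered_le [CompleteSpace U] [IsProbabilityMeasure μ] (h : IsWeight ρ μ w q)
    {f : Γ → U} (hf : StronglyMeasurable f) (hf2 : MemLp f 2 ρ) :
    ∫ y, ‖w y • f y - ∫ x, f x ∂ρ‖ ^ 2 ∂μ ≤ q * ∫ y, ‖f y‖ ^ 2 ∂ρ := by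
  have hL := h.memLp_smul hf hf2
  have hi := hL.integrable one_le_two
  set c := ∫ x, f x ∂ρ with hc
  have hc' : ∫ y, w y • f y ∂μ = c := (h.integral_eq f).symm
  have key : ∫ y, ‖w y • f y - c‖ ^ 2 ∂μ = ∫ y, ‖w y • f y‖ ^ 2 ∂μ - ‖c‖ ^ 2 := by
    simp_rw [norm_sub_sq_real]
    have i1 : Integrable (fun y => ‖w y • f y‖ ^ 2) μ := hL.integrable_sq_norm
    have i2 : Integrable (fun y => 2 * ⟪w y • f y, c⟫) μ := (hi.inner_const c).const_mul 2
    have i3 : Integrable (fun y => ‖w y • f y‖ ^ 2 - 2 * ⟪w y • f y, c⟫) μ := i1.sub i2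
    rw [integral_add i3 (integrable_const _), integral_sub i1 i2, integral_const_mul,
      integral_const]
    have : ∫ y, ⟪w y • f y, c⟫ ∂μ = ⟪c, c⟫ := by
      simp_rw [real_inner_comm c]
      rw [integral_inner hi, hc']
    rw [this, real_inner_self_eq_norm_sq]
    simp
    ring
  rw [key]
  linarith [h.integral_sq_norm_smul_le hf hf2, sq_nonneg ‖c‖]

/-- One step of stochastic gradient descent with a control variate, for a frozen past. With
`a = ∇g(u, ·)`, `b = ∇g(u*, ·)`, control variate `v` and idealized control variate `v'`, the
search direction is `w (a - v) + ∫ v dρ`; splitting it as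
`w (a - b) - (w (v - v') - ∫ (v - v')) + (w (b - v') - ∫ (b - v'))` separates the three
contributions. -/
theorem IsWeight.step_le [CompleteSpace U] [IsProbabilityMeasure ρ]
    [IsProbabilityMeasure μ] (h : IsWeight ρ μ w q) {a b v v' : Γ → U}
    (ha : StronglyMeasurable a) (hb : StronglyMeasurable b) (hv : StronglyMeasurable v)
    (hv' : StronglyMeasurable v') (ha2 : MemLp a 2 ρ) (hb2 : MemLp b 2 ρ) (hv2 : MemLp v 2 ρ)
    (hv'2 : MemLp v' 2 ρ) (hb0 : ∫ y, b y ∂ρ = 0) (e : U) (τ : ℝ) :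
    Integrable (fun y => ‖e - τ • (w y • (a y - v y) + ∫ x, v x ∂ρ)‖ ^ 2) μ ∧
    ∫ y, ‖e - τ • (w y • (a y - v y) + ∫ x, v x ∂ρ)‖ ^ 2 ∂μ ≤
      ‖e‖ ^ 2 - 2 * τ * ⟪e, ∫ y, a y ∂ρ⟫ + τ ^ 2 * (4 * (q * ∫ y, ‖a y - b y‖ ^ 2 ∂ρ)
        + 4 * (q * ∫ y, ‖v y - v' y‖ ^ 2 ∂ρ) + 2 * (q * ∫ y, ‖b y - v' y‖ ^ 2 ∂ρ)) := by
  have hX : MemLp (fun y => w y • (a y - v y) + ∫ x, v x ∂ρ) 2 μ :=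
    (h.memLp_smul (ha.sub hv) (ha2.sub hv2)).add (memLp_const _)
  have hXi := hX.integrable one_le_two
  have hXmean : ∫ y, (w y • (a y - v y) + ∫ x, v x ∂ρ) ∂μ = ∫ y, a y ∂ρ := by
    have i1 : Integrable (fun y => w y • (a y - v y)) μ :=
      (h.memLp_smul (ha.sub hv) (ha2.sub hv2)).integrable one_le_two
    rw [integral_add i1 (integrable_const _), integral_const, ← h.integral_eq (fun y => a y - v y),
      integral_sub (ha2.integrable one_le_two) (hv2.integrable one_le_two)]
    simp
  refine ⟨((memLp_const e).sub (hX.const_smul τ)).integrable_sq_norm, ?_⟩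
  have hexp : ∫ y, ‖e - τ • (w y • (a y - v y) + ∫ x, v x ∂ρ)‖ ^ 2 ∂μ
      = ‖e‖ ^ 2 - 2 * τ * ⟪e, ∫ y, a y ∂ρ⟫
        + τ ^ 2 * ∫ y, ‖w y • (a y - v y) + ∫ x, v x ∂ρ‖ ^ 2 ∂μ := by
    simp_rw [norm_sub_sq_real, inner_smul_right, norm_smul, mul_pow, Real.norm_eq_abs, sq_abs]
    have i1 : Integrable (fun y => τ ^ 2 * ‖w y • (a y - v y) + ∫ x, v x ∂ρ‖ ^ 2) μ :=
      hX.integrable_sq_norm.const_mul _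
    have i2 : Integrable (fun y => 2 * (τ * ⟪e, w y • (a y - v y) + ∫ x, v x ∂ρ⟫)) μ :=
      ((hXi.const_inner e).const_mul τ).const_mul 2
    have i3 : Integrable (fun y => ‖e‖ ^ 2
        - 2 * (τ * ⟪e, w y • (a y - v y) + ∫ x, v x ∂ρ⟫)) μ := (integrable_const _).sub i2
    rw [integral_add i3 i1, integral_sub (integrable_const _) i2,
      integral_const_mul, integral_const_mul, integral_const_mul, integral_inner hXi, hXmean]
    simp
    ring
  rw [hexp]
  gcongr
  have hA : MemLp (fun y => w y • (a y - b y)) 2 μ := h.memLp_smul (ha.sub hb) (ha2.sub hb2)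
  have hB : MemLp (fun y => w y • (v y - v' y) - ∫ x, (v x - v' x) ∂ρ) 2 μ :=
    (h.memLp_smul (hv.sub hv') (hv2.sub hv'2)).sub (memLp_const _)
  have hC : MemLp (fun y => w y • (b y - v' y) - ∫ x, (b x - v' x) ∂ρ) 2 μ :=
    (h.memLp_smul (hb.sub hv') (hb2.sub hv'2)).sub (memLp_const _)
  have eA := h.integral_sq_norm_smul_le (ha.sub hb) (ha2.sub hb2)
  have eB := h.integral_sq_norm_centered_le (hv.sub hv') (hv2.sub hv'2)
  have eC := h.integral_sq_norm_centered_le (hb.sub hv') (hb2.sub hv'2)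
  have iA := hA.integrable_sq_norm
  have iB := hB.integrable_sq_norm
  have iC := hC.integrable_sq_norm
  have hle : ∫ y, ‖w y • (a y - v y) + ∫ x, v x ∂ρ‖ ^ 2 ∂μ ≤
      ∫ y, (4 * ‖w y • (a y - b y)‖ ^ 2
        + 4 * ‖w y • (v y - v' y) - ∫ x, (v x - v' x) ∂ρ‖ ^ 2
        + 2 * ‖w y • (b y - v' y) - ∫ x, (b x - v' x) ∂ρ‖ ^ 2) ∂μ := by
    refine integral_mono hX.integrable_sq_norm
      (((iA.const_mul 4).add (iB.const_mul 4)).add (iC.const_mul 2)) fun y => ?_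
    have e1 : ∫ x, (v x - v' x) ∂ρ = ∫ x, v x ∂ρ - ∫ x, v' x ∂ρ :=
      integral_sub (hv2.integrable one_le_two) (hv'2.integrable one_le_two)
    have e2 : ∫ x, (b x - v' x) ∂ρ = - ∫ x, v' x ∂ρ := by
      rw [integral_sub (hb2.integrable one_le_two) (hv'2.integrable one_le_two), hb0, zero_sub]
    simp only [e1, e2]
    -- `X = (A - B) + C`, and `‖x + y‖² ≤ 2 ‖x‖² + 2 ‖y‖²` is applied twice, so that `C`, which
    -- carries the approximation error, gets the factor `2` and the others get `4`.
    set A := w y • (a y - b y)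
    set B := w y • (v y - v' y) - (∫ x, v x ∂ρ - ∫ x, v' x ∂ρ)
    set C := w y • (b y - v' y) - (- ∫ x, v' x ∂ρ)
    have hsplit : w y • (a y - v y) + ∫ x, v x ∂ρ = (A - B) + C := by
      simp only [A, B, C, smul_sub]; abel
    rw [hsplit]
    have p1 := parallelogram_law_with_norm ℝ (A - B) C
    have p2 := parallelogram_law_with_norm ℝ A B
    nlinarith [mul_self_nonneg ‖A - B - C‖, mul_self_nonneg ‖A + B‖]
  refine hle.trans ?_
  have iAB : Integrable (fun y => 4 * ‖w y • (a y - b y)‖ ^ 2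
      + 4 * ‖w y • (v y - v' y) - ∫ x, (v x - v' x) ∂ρ‖ ^ 2) μ :=
    (iA.const_mul 4).add (iB.const_mul 4)
  rw [integral_add iAB (iC.const_mul 2),
    integral_add (iA.const_mul 4) (iB.const_mul 4), integral_const_mul, integral_const_mul,
    integral_const_mul]
  simp only [Pi.sub_apply] at eA eB eC
  linarith

end Weighted

/-! ### The conditioned least-squares estimator -/

section Estimator

open Matrix

variable {U Γ : Type*} [NormedAddCommGroup U] [InnerProductSpace ℝ U]
  {φ : ℕ → Γ → U} {m : ℕ} {w : Γ → ℝ} {s : ℕ} {y : Fin s → Γ} {d : Fin s → U}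

/-- The element `∑_j c_j φ_j` of the approximation space. -/
def expand (φ : ℕ → Γ → U) {m : ℕ} (c : Fin m → ℝ) (x : Γ) : U := ∑ j, c j • φ j x

theorem expand_add (c c' : Fin m → ℝ) (x : Γ) :
    expand φ (c + c') x = expand φ c x + expand φ c' x := by
  simp [expand, add_smul, Finset.sum_add_distrib]

theorem expand_sub (c c' : Fin m → ℝ) (x : Γ) :
    expand φ (c - c') x = expand φ c x - expand φ c' x := by
  simp [expand, sub_smul, Finset.sum_sub_distrib]

theorem mem_approxSpace_iff {v : Γ → U} :
    v ∈ approxSpace φ m ↔ ∃ c : Fin m → ℝ, v = expand φ c := by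
  have h : φ '' Set.Iio m = Set.range fun j : Fin m => φ j := by
    ext f
    constructor
    · rintro ⟨j, hj, rfl⟩
      exact ⟨⟨j, hj⟩, rfl⟩
    · rintro ⟨j, rfl⟩
      exact ⟨j, j.2, rfl⟩
  rw [approxSpace, h, Submodule.mem_span_range_iff_exists_fun]
  refine exists_congr fun c => ?_
  rw [eq_comm]
  have : expand φ c = ∑ j, c j • φ j := by ext x; simp [expand]
  rw [this]

/-- The right-hand side `b_j = (1/s) ∑_l w(y_l) ⟨φ_j(y_l), d_l⟩` of the normal equations. -/
def normalRhs (φ : ℕ → Γ → U) (m : ℕ) (w : Γ → ℝ) {s : ℕ} (y : Fin s → Γ) (d : Fin s → U) :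
    Fin m → ℝ :=
  fun j => (1 / (s : ℝ)) * ∑ l, w (y l) * ⟪φ j (y l), d l⟫

open Classical in
/-- The coefficients of the conditioned least-squares estimator: the solution of the normal
equations if `‖G - I‖₂ ≤ 1/2`, and `0` otherwise. -/
def lsCoef (φ : ℕ → Γ → U) (m : ℕ) (w : Γ → ℝ) {s : ℕ} (y : Fin s → Γ) (d : Fin s → U) :
    Fin m → ℝ :=
  if spectralNorm (gram φ m w y - 1) ≤ 1 / 2 then (gram φ m w y)⁻¹ *ᵥ normalRhs φ m w y d else 0

theorem dotProduct_normalRhs (x : Fin m → ℝ) :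
    x ⬝ᵥ normalRhs φ m w y d = (1 / (s : ℝ)) * ∑ l, w (y l) * ⟪expand φ x (y l), d l⟫ := by
  simp only [dotProduct, normalRhs, expand, sum_inner, inner_smul_left, Finset.mul_sum]
  rw [Finset.sum_comm]
  refine Finset.sum_congr rfl fun l _ => Finset.sum_congr rfl fun j _ => ?_
  simp
  ring

theorem gram_mulVec (c : Fin m → ℝ) :
    gram φ m w y *ᵥ c = normalRhs φ m w y fun l => expand φ c (y l) := by
  ext i
  simp only [mulVec, dotProduct, gram, normalRhs, expand, inner_sum, inner_smul_right,
    Finset.mul_sum, Finset.sum_mul]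
  rw [Finset.sum_comm]
  refine Finset.sum_congr rfl fun l _ => Finset.sum_congr rfl fun j _ => ?_
  ring

theorem normalRhs_sub (d d' : Fin s → U) :
    normalRhs φ m w y (fun l => d l - d' l) = normalRhs φ m w y d - normalRhs φ m w y d' := by
  ext j
  simp [normalRhs, inner_sub_right, mul_sub, Finset.sum_sub_distrib]

/-- A Gram matrix within spectral distance `1/2` of the identity has smallest eigenvalue at least
`1/2`. -/
theorem half_sq_le_of_spectralNorm_le {G : Matrix (Fin m) (Fin m) ℝ}
    (hG : spectralNorm (G - 1) ≤ 1 / 2) (x : Fin m → ℝ) :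
    1 / 2 * ∑ j, x j ^ 2 ≤ x ⬝ᵥ G *ᵥ x := by
  have h1 := inner_toEuclideanCLM (G - 1) (WithLp.toLp 2 x) (WithLp.toLp 2 x)
  have h2 : |⟪WithLp.toLp 2 x, toEuclideanCLM (𝕜 := ℝ) (G - 1) (WithLp.toLp 2 x)⟫| ≤
      1 / 2 * ‖WithLp.toLp 2 x‖ ^ 2 := by
    refine (abs_real_inner_le_norm _ _).trans ?_
    have := (toEuclideanCLM (n := Fin m) (𝕜 := ℝ) (G - 1)).le_of_opNorm_le hG (WithLp.toLp 2 x)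
    nlinarith [norm_nonneg (WithLp.toLp 2 x)]
  rw [h1, EuclideanSpace.real_norm_sq_eq] at h2
  simp only [sub_mulVec, one_mulVec, dotProduct_sub] at h2
  have h3 : x ⬝ᵥ x = ∑ j, x j ^ 2 := by simp [dotProduct, sq]
  rw [h3] at h2
  linarith [neg_le_of_abs_le h2]

theorem isUnit_of_spectralNorm_le {G : Matrix (Fin m) (Fin m) ℝ}
    (hG : spectralNorm (G - 1) ≤ 1 / 2) : IsUnit G := by
  rw [← mulVec_injective_iff_isUnit]
  intro x x' hxx
  have h0 : G *ᵥ (x - x') = 0 := by rw [mulVec_sub, sub_eq_zero]; exact hxx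
  have h := half_sq_le_of_spectralNorm_le hG (x - x')
  rw [h0, dotProduct_zero] at h
  have hs : ∑ j, (x - x') j ^ 2 = 0 :=
    le_antisymm (by linarith) (Finset.sum_nonneg fun _ _ => sq_nonneg _)
  ext j
  have := (Finset.sum_eq_zero_iff_of_nonneg fun _ _ => sq_nonneg _).1 hs j (Finset.mem_univ j)
  exact sub_eq_zero.1 (by simpa using this)

theorem gram_mulVec_lsCoef (hG : spectralNorm (gram φ m w y - 1) ≤ 1 / 2) :
    gram φ m w y *ᵥ lsCoef φ m w y d = normalRhs φ m w y d := by
  rw [lsCoef, if_pos hG, mulVec_mulVec,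
    mul_nonsing_inv _ ((isUnit_iff_isUnit_det _).1 (isUnit_of_spectralNorm_le hG)), one_mulVec]

theorem lsCoef_sub (d d' : Fin s → U) :
    lsCoef φ m w y (fun l => d l - d' l) = lsCoef φ m w y d - lsCoef φ m w y d' := by
  by_cases hG : spectralNorm (gram φ m w y - 1) ≤ 1 / 2
  · simp only [lsCoef, if_pos hG, normalRhs_sub, mulVec_sub]
  · simp only [lsCoef, if_neg hG, sub_zero]

/-- Pythagoras for the empirical inner product: the loss at `∑_j (c + x)_j φ_j` exceeds the loss at
a solution `c` of the normal equations by the quadratic form of the Gram matrix at `x`. -/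
theorem lsLoss_expand_add {c : Fin m → ℝ}
    (hc : gram φ m w y *ᵥ c = normalRhs φ m w y d) (x : Fin m → ℝ) :
    lsLoss w y d (expand φ (c + x)) = lsLoss w y d (expand φ c) + x ⬝ᵥ gram φ m w y *ᵥ x := by
  have h0 : x ⬝ᵥ (normalRhs φ m w y fun l => expand φ c (y l) - d l) = 0 := by
    rw [normalRhs_sub, ← gram_mulVec, hc, sub_self, dotProduct_zero]
  rw [dotProduct_normalRhs] at h0
  rw [gram_mulVec, dotProduct_normalRhs, ← add_zero (lsLoss w y d (expand φ c)),
    ← mul_zero (2 : ℝ), ← h0]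
  simp only [lsLoss, Finset.mul_sum, ← Finset.sum_add_distrib]
  refine Finset.sum_congr rfl fun l _ => ?_
  rw [expand_add, show expand φ c (y l) + expand φ x (y l) - d l
    = (expand φ c (y l) - d l) + expand φ x (y l) by abel, norm_add_sq_real,
    real_inner_self_eq_norm_sq, real_inner_comm]
  ring

/-- The estimator is the expansion with coefficients `lsCoef`: under the condition on the Gram matrix
the minimizer exists and is unique as an element of the approximation space, so the choice made in
`leastSquares` does not matter. -/
theorem condLeastSquares_eq_expand :
    condLeastSquares φ m w y d = expand φ (lsCoef φ m w y d) := by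
  by_cases hG : spectralNorm (gram φ m w y - 1) ≤ 1 / 2
  · have hc := gram_mulVec_lsCoef (d := d) hG
    rw [condLeastSquares, if_pos hG, leastSquares]
    have hmin : ∀ v' ∈ approxSpace φ m,
        lsLoss w y d (expand φ (lsCoef φ m w y d)) ≤ lsLoss w y d v' := by
      intro v' hv'
      obtain ⟨c', rfl⟩ := mem_approxSpace_iff.1 hv'
      have h := lsLoss_expand_add hc (c' - lsCoef φ m w y d)
      have h2 := half_sq_le_of_spectralNorm_le hG (c' - lsCoef φ m w y d)
      have h3 : 0 ≤ ∑ j, (c' - lsCoef φ m w y d) j ^ 2 :=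
        Finset.sum_nonneg fun _ _ => sq_nonneg _
      rw [add_sub_cancel] at h
      linarith
    have hex : ∃ v, v ∈ approxSpace φ m ∧ ∀ v' ∈ approxSpace φ m, lsLoss w y d v ≤ lsLoss w y d v' :=
      ⟨_, mem_approxSpace_iff.2 ⟨_, rfl⟩, hmin⟩
    obtain ⟨h1, h2⟩ := Classical.epsilon_spec hex
    obtain ⟨c', hc'⟩ := mem_approxSpace_iff.1 h1
    have h4 := h2 _ (mem_approxSpace_iff.2 ⟨lsCoef φ m w y d, rfl⟩)
    rw [hc'] at h4 ⊢
    have h := lsLoss_expand_add hc (c' - lsCoef φ m w y d)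
    have h5 := half_sq_le_of_spectralNorm_le hG (c' - lsCoef φ m w y d)
    rw [add_sub_cancel] at h
    have h6 : ∑ j, (c' - lsCoef φ m w y d) j ^ 2 = 0 :=
      le_antisymm (by linarith) (Finset.sum_nonneg fun _ _ => sq_nonneg _)
    congr 1
    ext j
    have := (Finset.sum_eq_zero_iff_of_nonneg fun _ _ => sq_nonneg _).1 h6 j (Finset.mem_univ j)
    exact sub_eq_zero.1 (by simpa using this)
  · rw [condLeastSquares, if_neg hG, lsCoef, if_neg hG]
    ext x
    simp [expand]

/-- Stability of the conditioned estimator: conditioning keeps the smallest eigenvalue of the Gram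
matrix above `1/2`. -/
theorem sum_sq_lsCoef_le (hw : ∀ x, 0 ≤ w x) :
    ∑ j, lsCoef φ m w y d j ^ 2 ≤ 2 * ((1 / (s : ℝ)) * ∑ l, w (y l) * ‖d l‖ ^ 2) := by
  by_cases hG : spectralNorm (gram φ m w y - 1) ≤ 1 / 2
  · set c := lsCoef φ m w y d with hcdef
    have hc : gram φ m w y *ᵥ c = normalRhs φ m w y d := gram_mulVec_lsCoef hG
    have h1 := half_sq_le_of_spectralNorm_le hG c
    have h2 : c ⬝ᵥ gram φ m w y *ᵥ c
        = (1 / (s : ℝ)) * ∑ l, w (y l) * ⟪expand φ c (y l), expand φ c (y l)⟫ := by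
      rw [gram_mulVec, dotProduct_normalRhs]
    have h3 : c ⬝ᵥ gram φ m w y *ᵥ c
        = (1 / (s : ℝ)) * ∑ l, w (y l) * ⟪expand φ c (y l), d l⟫ := by
      rw [hc, dotProduct_normalRhs]
    have h4 : (1 / (s : ℝ)) * ∑ l, w (y l) * ⟪expand φ c (y l), d l⟫ ≤
        1 / 2 * ((1 / (s : ℝ)) * ∑ l, w (y l) * ⟪expand φ c (y l), expand φ c (y l)⟫)
          + 1 / 2 * ((1 / (s : ℝ)) * ∑ l, w (y l) * ‖d l‖ ^ 2) := by
      simp only [Finset.mul_sum, ← Finset.sum_add_distrib]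
      refine Finset.sum_le_sum fun l _ => ?_
      have h5 : ⟪expand φ c (y l), d l⟫ ≤
          1 / 2 * ⟪expand φ c (y l), expand φ c (y l)⟫ + 1 / 2 * ‖d l‖ ^ 2 := by
        have := sq_nonneg ‖expand φ c (y l) - d l‖
        rw [norm_sub_sq_real] at this
        rw [real_inner_self_eq_norm_sq]
        linarith
      have h6 := mul_le_mul_of_nonneg_left h5
        (mul_nonneg (one_div_nonneg.2 (Nat.cast_nonneg s : (0 : ℝ) ≤ s)) (hw (y l)))
      linarith
    linarith
  · simp only [lsCoef, if_neg hG]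
    simp only [Pi.zero_apply, ne_eq, OfNat.ofNat_ne_zero, not_false_eq_true, zero_pow,
      Finset.sum_const_zero]
    exact mul_nonneg zero_le_two (mul_nonneg (one_div_nonneg.2 (Nat.cast_nonneg s))
      (Finset.sum_nonneg fun l _ => mul_nonneg (hw _) (sq_nonneg _)))

end Estimator

/-! ### Measurability and orthonormal expansions -/

section Measurability

open Matrix

variable {U Γ Ω : Type*} [NormedAddCommGroup U] [InnerProductSpace ℝ U]
  [MeasurableSpace Γ] {φ : ℕ → Γ → U} {m : ℕ} {w : Γ → ℝ} {s : ℕ} {ρ : Measure Γ}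

theorem IsApproxBasis.stronglyMeasurable_expand (h : IsApproxBasis ρ φ m) (c : Fin m → ℝ) :
    StronglyMeasurable (expand φ c) := by
  unfold expand
  exact Finset.stronglyMeasurable_fun_sum _ fun j _ => (h.measurable j j.2).const_smul (c j)

theorem IsApproxBasis.memLp_expand (h : IsApproxBasis ρ φ m) (c : Fin m → ℝ) :
    MemLp (expand φ c) 2 ρ := by
  unfold expand
  exact memLp_finsetSum _ fun j _ => (h.memLp j j.2).const_smul (c j)

theorem IsApproxBasis.integral_sq_norm_expand (h : IsApproxBasis ρ φ m) (c : Fin m → ℝ) :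
    ∫ y, ‖expand φ c y‖ ^ 2 ∂ρ = ∑ j, c j ^ 2 := by
  have hi : ∀ i j : Fin m, Integrable (fun y => ⟪φ i y, φ j y⟫) ρ := fun i j =>
    ((h.memLp i i.2).norm.integrable_mul (h.memLp j j.2).norm).mono'
      ((h.measurable i i.2).inner (h.measurable j j.2)).aestronglyMeasurable
      (Eventually.of_forall fun y => norm_inner_le_norm _ _)
  simp_rw [← real_inner_self_eq_norm_sq, expand, sum_inner, inner_sum, inner_smul_left,
    inner_smul_right]
  rw [integral_finsetSum _ fun i _ => integrable_finsetSum _ fun j _ =>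
    ((hi i j).const_mul _).const_mul _]
  refine Finset.sum_congr rfl fun i _ => ?_
  rw [integral_finsetSum _ fun j _ => ((hi i j).const_mul _).const_mul _]
  simp_rw [integral_const_mul, h.orthonormal _ (Fin.is_lt _) _ (Fin.is_lt _), Fin.val_inj]
  simp [sq]

/-- The coefficients depend measurably on the data: the inverse in `lsCoef` is a rational function of
the entries of the Gram matrix, and the condition defines a measurable set. -/
theorem stronglyMeasurable_lsCoef {mΩ : MeasurableSpace Ω} (h : IsApproxBasis ρ φ m)
    (hw : Measurable w) {y : Ω → Fin s → Γ} {d : Ω → Fin s → U}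
    (hy : ∀ l, Measurable fun ω => y ω l) (hd : ∀ l, StronglyMeasurable fun ω => d ω l) (j : Fin m) :
    StronglyMeasurable fun ω => lsCoef φ m w (y ω) (d ω) j := by
  have hφ : ∀ (i : Fin m) l, StronglyMeasurable fun ω => φ i (y ω l) := fun i l =>
    (h.measurable i i.2).comp_measurable (hy l)
  have hwy : ∀ l, StronglyMeasurable fun ω => w (y ω l) := fun l =>
    (hw.comp (hy l)).stronglyMeasurable
  have hG : Measurable fun ω => fun i k => gram φ m w (y ω) i k :=
    measurable_pi_iff.2 fun i => measurable_pi_iff.2 fun j =>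
      ((Finset.stronglyMeasurable_fun_sum _ fun l _ =>
        (hwy l).mul ((hφ i l).inner (hφ j l))).const_mul _).measurable
  have hid : Continuous fun M : Fin m → Fin m → ℝ => Matrix.of M := continuous_id
  have hR : ∀ i, StronglyMeasurable fun ω => normalRhs φ m w (y ω) (d ω) i := fun i =>
    (Finset.stronglyMeasurable_fun_sum _ fun l _ =>
      (hwy l).mul ((hφ i l).inner (hd l))).const_mul _
  have hN : Continuous fun M : Fin m → Fin m → ℝ => spectralNorm (Matrix.of M - 1) := by
    unfold spectralNorm
    refine Continuous.norm ?_
    have h1 : Continuous (toEuclideanCLM (n := Fin m) (𝕜 := ℝ)) :=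
      LinearMap.continuous_of_finiteDimensional
        (IsLinearMap.mk' (toEuclideanCLM (n := Fin m) (𝕜 := ℝ)) ⟨map_add _, map_smul _⟩)
    exact h1.comp (hid.sub continuous_const)
  have hset : MeasurableSet {ω | spectralNorm (gram φ m w (y ω) - 1) ≤ 1 / 2} :=
    measurableSet_le (hN.measurable.comp hG) measurable_const
  have hdet : Measurable fun ω => (gram φ m w (y ω)).det :=
    hid.matrix_det.measurable.comp hG
  have hadj : ∀ i k, Measurable fun ω => Matrix.adjugate (gram φ m w (y ω)) i k := fun i k =>
    (hid.matrix_adjugate.matrix_elem i k).measurable.comp hG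
  have heq : (fun ω => lsCoef φ m w (y ω) (d ω) j) =
      Set.indicator {ω | spectralNorm (gram φ m w (y ω) - 1) ≤ 1 / 2} fun ω =>
        ∑ i, ((gram φ m w (y ω)).det)⁻¹ * Matrix.adjugate (gram φ m w (y ω)) j i *
          normalRhs φ m w (y ω) (d ω) i := by
    ext ω
    by_cases hω : spectralNorm (gram φ m w (y ω) - 1) ≤ 1 / 2
    · rw [Set.indicator_of_mem (s := {ω | spectralNorm (gram φ m w (y ω) - 1) ≤ 1 / 2}) hω, lsCoef, if_pos hω, Matrix.inv_def]
      simp [mulVec, dotProduct]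
    · rw [Set.indicator_of_notMem (s := {ω | spectralNorm (gram φ m w (y ω) - 1) ≤ 1 / 2}) hω, lsCoef, if_neg hω]
      rfl
  rw [heq]
  refine StronglyMeasurable.indicator ?_ hset
  exact Finset.stronglyMeasurable_fun_sum _ fun i _ =>
    (hdet.inv.mul (hadj j i)).stronglyMeasurable.mul (hR i)

theorem stronglyMeasurable_expand_comp {𝓧 : Type*} {m𝓧 : MeasurableSpace 𝓧} (h : IsApproxBasis ρ φ m) {c : 𝓧 → Fin m → ℝ}
    (hc : ∀ j, StronglyMeasurable fun x => c x j) {Z : 𝓧 → Γ} (hZ : Measurable Z) :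
    StronglyMeasurable fun x => expand φ (c x) (Z x) := by
  unfold expand
  exact Finset.stronglyMeasurable_fun_sum _ fun j _ =>
    (hc j).smul ((h.measurable j j.2).comp_measurable hZ)

theorem stronglyMeasurable_integral_expand {𝓧 : Type*} {m𝓧 : MeasurableSpace 𝓧} [IsFiniteMeasure ρ]
    (h : IsApproxBasis ρ φ m) {c : 𝓧 → Fin m → ℝ}
    (hc : ∀ j, StronglyMeasurable fun x => c x j) :
    StronglyMeasurable fun x => ∫ y, expand φ (c x) y ∂ρ := by
  have heq : (fun x => ∫ y, expand φ (c x) y ∂ρ) = fun x => ∑ j, c x j • ∫ y, φ j y ∂ρ := by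
    ext x
    unfold expand
    have hi : ∀ j ∈ (Finset.univ : Finset (Fin m)), Integrable (fun y => c x j • φ j y) ρ :=
      fun j _ => ((h.memLp j j.2).integrable one_le_two).smul (c x j)
    rw [integral_finsetSum _ hi]
    simp_rw [integral_smul]
  rw [heq]
  exact Finset.stronglyMeasurable_fun_sum _ fun j _ => (hc j).smul_const _

end Measurability

/-! ### Sampling schemes -/

section Scheme

variable {U Γ : Type*} [NormedAddCommGroup U] [InnerProductSpace ℝ U] [MeasurableSpace Γ]
  {ρ : Measure Γ} {φ : ℕ → Γ → U} {m : ℕ → ℕ}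

/-- What the fixed and the optimal sampling have in common: `w_p = dρ/dμ_p`, and resampling turns
a draw from `μ_p` into a draw from `μ_{p+1}`. -/
structure SamplingScheme.IsConsistent (S : SamplingScheme Γ) (ρ : Measure Γ) : Prop where
  weight : ∀ p, IsWeight ρ (S.μ p) (S.w p) (⨆ y, S.w p y)
  keep_nonneg : ∀ p, 0 ≤ S.keep p
  keep_le_one : ∀ p, S.keep p ≤ 1
  const : ∀ p, S.keep p = 1 → S.μ (p + 1) = S.μ p
  mixture : ∀ p, S.keep p < 1 → S.μ (p + 1) =
    ENNReal.ofReal (S.keep p) • S.μ p + ENNReal.ofReal (1 - S.keep p) • S.redrawLaw p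

theorem IsApproxBasis.sum_sq_norm_pos {n : ℕ} (h : IsApproxBasis ρ φ n) (y : Γ) :
    0 < ∑ j ∈ Finset.range n, ‖φ j y‖ ^ 2 := by
  by_contra hneg
  have h0 : ∑ j ∈ Finset.range n, ‖φ j y‖ ^ 2 = 0 :=
    le_antisymm (not_lt.1 hneg) (Finset.sum_nonneg fun _ _ => sq_nonneg _)
  obtain ⟨v, hv, hvy⟩ := h.nonvanishing y
  obtain ⟨c, rfl⟩ := mem_approxSpace_iff.1 hv
  refine hvy (Finset.sum_eq_zero fun j _ => ?_)
  have := (Finset.sum_eq_zero_iff_of_nonneg fun _ _ => sq_nonneg _).1 h0 j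
    (Finset.mem_range.2 j.2)
  rw [norm_eq_zero.1 (pow_eq_zero_iff two_ne_zero |>.1 this), smul_zero]

theorem IsApproxBasis.pos [Nonempty Γ] {n : ℕ} (h : IsApproxBasis ρ φ n) : 0 < n := by
  rcases Nat.eq_zero_or_pos n with rfl | hn
  · simpa using h.sum_sq_norm_pos (Classical.arbitrary Γ)
  · exact hn

theorem IsApproxBasis.measurable_sum_sq_norm {n : ℕ} (h : IsApproxBasis ρ φ n) {t : Finset ℕ}
    (ht : ∀ j ∈ t, j < n) : Measurable fun y => ∑ j ∈ t, ‖φ j y‖ ^ 2 :=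
  Finset.measurable_fun_sum _ fun j hj => ((h.measurable j (ht j hj)).norm.pow 2).measurable

/-- The optimal measures form a consistent scheme: the density of `μ_{p+1}` splits at index `m_p`
into the density of `μ_p` and that of the redraw law. -/
theorem optimalSampling_isConsistent [Nonempty Γ] (hbasis : ∀ p, IsApproxBasis ρ φ (m p))
    (hm : Monotone m)
    (hbdd : ∀ p, BddAbove (Set.range ((optimalSampling ρ φ m).w p))) :
    (optimalSampling ρ φ m).IsConsistent ρ := by
  have hpos : ∀ p, (0 : ℝ) < m p := fun p => Nat.cast_pos.2 (hbasis p).pos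
  have hmeas : ∀ p, Measurable fun y => ∑ j ∈ Finset.range (m p), ‖φ j y‖ ^ 2 := fun p =>
    (hbasis p).measurable_sum_sq_norm fun j hj => Finset.mem_range.1 hj
  have hwmeas : ∀ p, Measurable fun y => (m p : ℝ) / ∑ j ∈ Finset.range (m p), ‖φ j y‖ ^ 2 :=
    fun p => measurable_const.div (hmeas p)
  refine ⟨fun p => ⟨hwmeas p, fun y => ?_, fun y => ?_, ?_⟩, fun p => ?_,
    fun p => ?_, fun p hp => ?_, fun p hp => ?_⟩
  · exact div_nonneg (hpos p).le ((hbasis p).sum_sq_norm_pos y).le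
  · exact le_ciSup (hbdd p) y
  · simp only [optimalSampling]
    rw [← withDensity_mul ρ ((hmeas p).const_mul _).ennreal_ofReal
      (hwmeas p).ennreal_ofReal]
    conv_lhs => rw [← withDensity_one (μ := ρ)]
    congr 1
    ext y
    have h1 := (hbasis p).sum_sq_norm_pos y
    have h2 := hpos p
    rw [Pi.mul_apply, ← ENNReal.ofReal_mul (by positivity)]
    rw [show 1 / (m p : ℝ) * (∑ j ∈ Finset.range (m p), ‖φ j y‖ ^ 2) *
      ((m p : ℝ) / ∑ j ∈ Finset.range (m p), ‖φ j y‖ ^ 2) = 1 by field_simp]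
    simp
  · exact div_nonneg (hpos p).le (hpos (p + 1)).le
  · exact div_le_one_of_le₀ (Nat.cast_le.2 (hm p.le_succ)) (hpos (p + 1)).le
  · have : m p = m (p + 1) := by
      have := (div_eq_one_iff_eq (hpos (p + 1)).ne').1 hp
      exact_mod_cast this
    simp only [optimalSampling, this]
  · have hlt : (m p : ℝ) < m (p + 1) := (div_lt_one (hpos (p + 1))).1 hp
    have hmeas' : Measurable fun y => ∑ j ∈ Finset.Ico (m p) (m (p + 1)), ‖φ j y‖ ^ 2 :=
      (hbasis (p + 1)).measurable_sum_sq_norm fun j hj => (Finset.mem_Ico.1 hj).2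
    simp only [optimalSampling]
    rw [← withDensity_smul _ ((hmeas p).const_mul _).ennreal_ofReal,
      ← withDensity_smul _ (hmeas'.const_mul _).ennreal_ofReal,
      ← withDensity_add_left (((hmeas p).const_mul _).ennreal_ofReal.const_smul _)]
    congr 1
    ext y
    have h2 := hpos p
    have h3 := hpos (p + 1)
    have h4 : (0 : ℝ) < m (p + 1) - m p := sub_pos.2 hlt
    have h5 : (0 : ℝ) ≤ 1 - m p / m (p + 1) := sub_nonneg.2 ((div_lt_one h3).2 hlt).le
    have h6 : 0 ≤ ∑ j ∈ Finset.range (m p), ‖φ j y‖ ^ 2 :=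
      Finset.sum_nonneg fun _ _ => sq_nonneg _
    have h7 : 0 ≤ ∑ j ∈ Finset.Ico (m p) (m (p + 1)), ‖φ j y‖ ^ 2 :=
      Finset.sum_nonneg fun _ _ => sq_nonneg _
    simp only [Pi.add_apply, Pi.smul_apply, smul_eq_mul]
    rw [← ENNReal.ofReal_mul (by positivity), ← ENNReal.ofReal_mul h5,
      ← ENNReal.ofReal_add (by positivity) (by positivity),
      ← Finset.sum_range_add_sum_Ico _ (hm p.le_succ)]
    congr 1
    field_simp

theorem SamplingScheme.IsAdmissible.isConsistent [Nonempty Γ] {S : SamplingScheme Γ}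
    (hS : S.IsAdmissible ρ φ m) (hbasis : ∀ p, IsApproxBasis ρ φ (m p)) (hm : Monotone m)
    (hbdd : ∀ p, BddAbove (Set.range (S.w p))) : S.IsConsistent ρ := by
  rcases hS with ⟨μ, w, -, hw, hw0, hρ, rfl⟩ | rfl
  · exact ⟨fun p => ⟨hw, hw0, fun y => le_ciSup (hbdd p) y, hρ⟩, fun _ => zero_le_one,
      fun _ => le_rfl, fun _ _ => rfl, fun _ h => absurd h (lt_irrefl _)⟩
  · exact optimalSampling_isConsistent hbasis hm hbdd

end Scheme

/-! ### The schedule of phases -/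

section Schedule

variable {U Γ : Type*} [NormedAddCommGroup U] [InnerProductSpace ℝ U] [MeasurableSpace Γ]
  {ρ : Measure Γ} {A : Params U Γ}

theorem Params.IsAdmissible.lt_sched_phase_succ (hA : A.IsAdmissible ρ) (k : ℕ) :
    k < A.σ (A.phase k + 1) := by
  have hne : {p | k < A.σ (p + 1)}.Nonempty := by
    obtain ⟨p, hp⟩ := ((tendsto_add_atTop_iff_nat 1).2 hA.sched_tendsto).eventually_gt_atTop k
      |>.exists
    exact ⟨p, hp⟩
  exact Nat.sInf_mem hne

theorem Params.IsAdmissible.sched_phase_le (hA : A.IsAdmissible ρ) (k : ℕ) :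
    A.σ (A.phase k) ≤ k := by
  rcases hp : A.phase k with _ | p
  · rw [hA.sched_zero]; exact Nat.zero_le k
  · exact not_lt.1 (Nat.notMem_of_lt_sInf (s := {p | k < A.σ (p + 1)})
      (show p < A.phase k by omega))

theorem Params.IsAdmissible.phase_eq (hA : A.IsAdmissible ρ) {k p : ℕ} (h1 : A.σ p ≤ k)
    (h2 : k < A.σ (p + 1)) : A.phase k = p := by
  refine le_antisymm (Nat.sInf_le h2) ?_
  by_contra hlt
  have h3 := hA.lt_sched_phase_succ k
  have h4 := hA.sched_mono (show A.phase k + 1 ≤ p by omega)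
  omega

/-- The oldest data point needed in phase `p + 1` is not older than the oldest one of phase `p`. -/
theorem Params.IsAdmissible.window_mono (hA : A.IsAdmissible ρ) :
    Monotone fun p => (A.σ p : ℤ) - A.s p :=
  monotone_nat_of_le_succ fun p => by
    have := hA.size_growth p
    omega

theorem Params.IsAdmissible.neg_size_le (hA : A.IsAdmissible ρ) (p : ℕ) :
    -(A.s 0 : ℤ) ≤ (A.σ p : ℤ) - A.s p := by
  have h := hA.window_mono (Nat.zero_le p)
  simp only [hA.sched_zero] at h
  omega

theorem Params.IsAdmissible.neg_size_le_sub (hA : A.IsAdmissible ρ) (k : ℕ) :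
    -(A.s 0 : ℤ) ≤ (k : ℤ) - A.size k := by
  have h1 := hA.neg_size_le (A.phase k)
  have h2 := hA.sched_phase_le k
  simp only [Params.size]
  omega

end Schedule

/-! ### Laws and independence of the data points -/

section Independence

variable {U Γ Ω : Type*} [MeasurableSpace Γ] {ρ : Measure Γ} {A : Params U Γ} {D : Draws Ω Γ} {𝓐 : MeasurableSpace Ω}

/-- The sources attached to data points older than `j`, together with the initial randomness.
Resampling of an old data point counts as old, at whatever iteration it takes place. -/
def sourcesBefore (j : ℤ) : Set Source :=
  {s | match s with
    | Source.init => True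
    | Source.draw i => i < j
    | Source.coin _ i => i < j
    | Source.redraw _ i => i < j}

/-- The sources that determine the value of data point `j` in phase `p`. -/
def sourcesOf (p : ℕ) (j : ℤ) : Set Source :=
  {s | match s with
    | Source.init => False
    | Source.draw i => i = j
    | Source.coin p' i => p' < p ∧ i = j
    | Source.redraw p' i => p' < p ∧ i = j}

/-- The information carried by the data points older than `j`. -/
@[reducible]
def Draws.past (D : Draws Ω Γ) (𝓐 : MeasurableSpace Ω) (j : ℤ) : MeasurableSpace Ω :=
  ⨆ s ∈ sourcesBefore j, D.sigma 𝓐 s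

theorem Draws.sigma_le_past {s : Source} {j : ℤ} (hs : s ∈ sourcesBefore j) :
    D.sigma 𝓐 s ≤ D.past 𝓐 j :=
  le_iSup₂ (f := fun s (_ : s ∈ sourcesBefore j) => D.sigma 𝓐 s) s hs

theorem Draws.past_mono {i j : ℤ} (hij : i ≤ j) : D.past 𝓐 i ≤ D.past 𝓐 j := by
  refine iSup₂_le fun s hs => Draws.sigma_le_past ?_
  rcases s with _ | a | ⟨p, a⟩ | ⟨p, a⟩
  · trivial
  all_goals exact lt_of_lt_of_le hs hij

theorem disjoint_sourcesBefore_sourcesOf {p : ℕ} {j : ℤ} :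
    Disjoint (sourcesBefore j) (sourcesOf p j) := by
  rw [Set.disjoint_left]
  rintro (_ | a | ⟨p', a⟩ | ⟨p', a⟩) h1 h2
  · exact h2
  · exact absurd (show a = j from h2) (ne_of_lt h1)
  · exact absurd h2.2 (ne_of_lt h1)
  · exact absurd h2.2 (ne_of_lt h1)

theorem Draws.measurable_point (p : ℕ) (j : ℤ) :
    Measurable[⨆ s ∈ sourcesOf p j, D.sigma 𝓐 s] (D.point A p j) := by
  have hle : ∀ {p s}, s ∈ sourcesOf p j →
      D.sigma 𝓐 s ≤ ⨆ s ∈ sourcesOf p j, D.sigma 𝓐 s := fun {p s} hs =>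
    le_iSup₂ (f := fun s (_ : s ∈ sourcesOf p j) => D.sigma 𝓐 s) s hs
  induction p with
  | zero =>
    exact (comap_measurable (D.Y j)).mono (hle (s := Source.draw j) rfl) le_rfl
  | succ p ih =>
    have hmono : (⨆ s ∈ sourcesOf p j, D.sigma 𝓐 s) ≤ ⨆ s ∈ sourcesOf (p + 1) j, D.sigma 𝓐 s := by
      refine iSup₂_le fun s hs => hle ?_
      rcases s with _ | a | ⟨p', a⟩ | ⟨p', a⟩
      · exact hs
      · exact hs
      · exact ⟨hs.1.trans p.lt_succ_self, hs.2⟩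
      · exact ⟨hs.1.trans p.lt_succ_self, hs.2⟩
    have hcoin : Measurable[⨆ s ∈ sourcesOf (p + 1) j, D.sigma 𝓐 s] (D.coin p j) :=
      (comap_measurable (D.coin p j)).mono
        (hle (s := Source.coin p j) ⟨p.lt_succ_self, rfl⟩) le_rfl
    have hre : Measurable[⨆ s ∈ sourcesOf (p + 1) j, D.sigma 𝓐 s] (D.redraw p j) :=
      (comap_measurable (D.redraw p j)).mono
        (hle (s := Source.redraw p j) ⟨p.lt_succ_self, rfl⟩) le_rfl
    refine Measurable.ite ?_ hre (ih.mono hmono le_rfl)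
    refine MeasurableSet.inter (MeasurableSet.const _) ?_
    exact hcoin (measurableSet_singleton false)

theorem Draws.measurable_point_past {p : ℕ} {i j : ℤ} (hij : i < j) :
    Measurable[D.past 𝓐 j] (D.point A p i) := by
  refine (Draws.measurable_point (𝓐 := 𝓐) p i).mono (iSup₂_le fun s hs => ?_) le_rfl
  refine Draws.sigma_le_past ?_
  rcases s with _ | a | ⟨p', a⟩ | ⟨p', a⟩
  · exact hs.elim
  · exact lt_of_eq_of_lt hs hij
  · exact lt_of_eq_of_lt hs.2 hij
  · exact lt_of_eq_of_lt hs.2 hij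

/-- A data point that has not met a switch of phases is the original draw. -/
theorem Draws.point_eq_draw (hσ : Monotone A.σ) {p : ℕ} {j : ℤ} (h : (A.σ p : ℤ) ≤ j) :
    D.point A p j = D.Y j := by
  induction p with
  | zero => rfl
  | succ p ih =>
    ext ω
    rw [Draws.point, if_neg fun hc => absurd hc.1.2 (not_lt.2 h),
      ih ((Nat.cast_le.2 (hσ p.le_succ)).trans h)]

variable [mΩ : MeasurableSpace Ω] {P : Measure Ω}

theorem Draws.IsSample.sigma_le (hD : D.IsSample 𝓐 P A) (s : Source) : D.sigma 𝓐 s ≤ mΩ := by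
  rcases s with _ | j | ⟨p, j⟩ | ⟨p, j⟩
  · exact hD.init_le
  · exact (hD.measurable_Y j).comap_le
  · exact (hD.measurable_coin p j).comap_le
  · exact (hD.measurable_redraw p j).comap_le

theorem Draws.IsSample.past_le (hD : D.IsSample 𝓐 P A) (j : ℤ) : D.past 𝓐 j ≤ mΩ :=
  iSup₂_le fun s _ => hD.sigma_le s

theorem Draws.IsSample.measurable_point (hD : D.IsSample 𝓐 P A) (p : ℕ) (j : ℤ) :
    Measurable (D.point A p j) :=
  (Draws.measurable_point_past (𝓐 := 𝓐) (lt_add_one j)).mono (hD.past_le _) le_rfl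

/-- A data point is independent of everything attached to the older data points, in whatever phase
it is looked at: its own value changes at a switch by sources carrying its own index. -/
theorem Draws.IsSample.indep_past_point (hD : D.IsSample 𝓐 P A) (p : ℕ) (j : ℤ) :
    Indep (D.past 𝓐 j) (MeasurableSpace.comap (D.point A p j) inferInstance) P :=
  indep_of_indep_of_le_right
    (indep_iSup_of_disjoint hD.sigma_le hD.indep disjoint_sourcesBefore_sourcesOf)
    (Draws.measurable_point (𝓐 := 𝓐) p j).comap_le

theorem map_ite_bool {B : Ω → Bool} {X Z : Ω → Γ} (hB : Measurable B) (hX : Measurable X)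
    (hZ : Measurable Z) (hBX : IndepFun B X P) (hBZ : IndepFun B Z P) :
    P.map (fun ω => if B ω = false then Z ω else X ω) =
      P (B ⁻¹' {true}) • P.map X + P (B ⁻¹' {false}) • P.map Z := by
  have hf : MeasurableSet (B ⁻¹' {false}) := hB (measurableSet_singleton _)
  have ht : MeasurableSet (B ⁻¹' {true}) := hB (measurableSet_singleton _)
  have hm : Measurable (fun ω => if B ω = false then Z ω else X ω) := Measurable.ite hf hZ hX
  ext t hts
  rw [Measure.map_apply hm hts, Measure.add_apply, Measure.smul_apply, Measure.smul_apply,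
    Measure.map_apply hX hts, Measure.map_apply hZ hts, smul_eq_mul, smul_eq_mul,
    ← hBX.measure_inter_preimage_eq_mul _ _ (measurableSet_singleton _) hts,
    ← hBZ.measure_inter_preimage_eq_mul _ _ (measurableSet_singleton _) hts,
    ← measure_union _ (hf.inter (hZ hts))]
  · congr 1
    ext ω
    cases h : B ω <;> simp [h]
  · rw [Set.disjoint_left]
    rintro ω ⟨h1, -⟩ ⟨h2, -⟩
    rw [Set.mem_preimage, Set.mem_singleton_iff] at h1 h2
    rw [h1] at h2
    exact Bool.noConfusion h2

/-- In phase `p` every data point of the memory has the law `μ_p`: a new one by definition, an old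
one because resampling at the switches preserves this property. -/
theorem Draws.IsSample.map_point [NormedAddCommGroup U] [InnerProductSpace ℝ U]
    [IsProbabilityMeasure P] (hD : D.IsSample 𝓐 P A)
    (hA : A.IsAdmissible ρ) (hS : A.S.IsConsistent ρ) {p : ℕ} {j : ℤ}
    (h1 : (A.σ p : ℤ) - A.s p ≤ j) (h2 : j < A.σ (p + 1)) :
    P.map (D.point A p j) = A.S.μ p := by
  have hnew : ∀ p : ℕ, (A.σ p : ℤ) ≤ j → j < A.σ (p + 1) → P.map (D.point A p j) = A.S.μ p := by
    intro p hp1 hp2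
    lift j to ℕ using (Int.natCast_nonneg _).trans hp1
    rw [Draws.point_eq_draw hA.sched_mono hp1, hD.law_Y,
      hA.phase_eq (by exact_mod_cast hp1) (by exact_mod_cast hp2)]
  induction p with
  | zero =>
    rcases le_or_gt (A.σ 0 : ℤ) j with h | h
    · exact hnew 0 h h2
    · rw [hA.sched_zero] at h1 h
      exact hD.law_init j (by simpa using h1) (by simpa using h)
  | succ p ih =>
    rcases le_or_gt (A.σ (p + 1) : ℤ) j with h | h
    · exact hnew (p + 1) h h2
    · have hpt := ih ((hA.window_mono p.le_succ).trans h1) h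
      have hcoinX : IndepFun (D.coin p j) (D.point A p j) P := by
        refine indep_of_indep_of_le_right (indep_of_indep_of_le_left
          (indep_iSup_of_disjoint (S := {Source.coin p j}) (T := sourcesOf p j)
            hD.sigma_le hD.indep ?_) ?_) (Draws.measurable_point (𝓐 := 𝓐) p j).comap_le
        · exact Set.disjoint_singleton_left.2 fun hmem => lt_irrefl p hmem.1
        · exact le_iSup₂ (f := fun s (_ : s ∈ ({Source.coin p j} : Set Source)) => D.sigma 𝓐 s)
            (Source.coin p j) rfl
      have hcoinZ : IndepFun (D.coin p j) (D.redraw p j) P :=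
        hD.indep.indep (i := Source.coin p j) (j := Source.redraw p j) (by simp)
      have heq : D.point A (p + 1) j =
          fun ω => if D.coin p j ω = false then D.redraw p j ω else D.point A p j ω := by
        ext ω
        simp only [Draws.point, h1, h, and_self, true_and]
      have htrue := hD.law_coin p j
      have hfalse : P (D.coin p j ⁻¹' {false}) = ENNReal.ofReal (1 - A.S.keep p) := by
        have hc : D.coin p j ⁻¹' {false} = (D.coin p j ⁻¹' {true})ᶜ := by
          ext ω; simp
        rw [hc, prob_compl_eq_one_sub (hD.measurable_coin p j (measurableSet_singleton _)), htrue,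
          ENNReal.ofReal_sub _ (hS.keep_nonneg p), ENNReal.ofReal_one]
      rw [heq, map_ite_bool (hD.measurable_coin p j) (hD.measurable_point p j)
        (hD.measurable_redraw p j) hcoinX hcoinZ, htrue, hfalse, hpt]
      rcases (hS.keep_le_one p).lt_or_eq with hlt | heq1
      · rw [hD.law_redraw p j hlt, hS.mixture p hlt]
      · rw [hS.const p heq1, heq1]
        simp

theorem Draws.IsSample.map_memory [NormedAddCommGroup U] [InnerProductSpace ℝ U]
    [IsProbabilityMeasure P] (hD : D.IsSample 𝓐 P A) (hA : A.IsAdmissible ρ)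
    (hS : A.S.IsConsistent ρ) (k : ℕ) (l : Fin (A.size k)) :
    P.map (fun ω => D.memory A k ω l) = A.S.μ (A.phase k) := by
  have h1 := hA.sched_phase_le k
  have h2 := hA.lt_sched_phase_succ k
  have hl : (l : ℕ) < A.s (A.phase k) := l.2
  exact hD.map_point hA hS (by omega) (by omega)

end Independence

/-! ### Integrating out an independent variable -/

section Freezing

variable {Γ Ω : Type*} {mΓ : MeasurableSpace Γ}

theorem lintegral_comp_prodMk_of_indepFun {𝓧 : Type*} {m𝓧 : MeasurableSpace 𝓧}
    {mΩ : MeasurableSpace Ω} {P : Measure Ω} [IsProbabilityMeasure P] {X : Ω → 𝓧} {Z : Ω → Γ}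
    (hX : Measurable X) (hZ : Measurable Z) (h : IndepFun X Z P) {f : 𝓧 × Γ → ENNReal}
    (hf : Measurable f) :
    ∫⁻ ω, f (X ω, Z ω) ∂P = ∫⁻ ω, ∫⁻ y, f (X ω, y) ∂(P.map Z) ∂P := by
  have := Measure.isProbabilityMeasure_map (μ := P) hZ.aemeasurable
  rw [← lintegral_map hf (hX.prodMk hZ), h.map_prod_eq_prod_map_map hX.aemeasurable hZ.aemeasurable,
    lintegral_prod _ hf.aemeasurable, lintegral_map hf.lintegral_prod_right' hX]

/-- Freezing: if `Z` is independent of `m` and `h` is `m`-measurable in its first argument, then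
`E[h(ω, Z)]` is bounded by integrating out `Z` first, for fixed `ω`. Integrability comes for
free. -/
theorem integrable_and_integral_le_of_indep {m mΩ : MeasurableSpace Ω} {P : Measure Ω}
    [IsProbabilityMeasure P] (hm : m ≤ mΩ) {Z : Ω → Γ} (hZ : Measurable Z)
    (hind : Indep m (MeasurableSpace.comap Z mΓ) P) {h : Ω → Γ → ℝ}
    (hmeas : Measurable[m.prod mΓ] fun z : Ω × Γ => h z.1 z.2) (hnn : ∀ ω y, 0 ≤ h ω y)
    {R : Ω → ℝ} (hR : Integrable R P) (hint : ∀ ω, Integrable (h ω) (P.map Z))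
    (hle : ∀ ω, ∫ y, h ω y ∂(P.map Z) ≤ R ω) :
    Integrable (fun ω => h ω (Z ω)) P ∧ ∫ ω, h ω (Z ω) ∂P ≤ ∫ ω, R ω ∂P := by
  have hX : Measurable[mΩ, m] (id : Ω → Ω) := measurable_id'' hm
  have hindF : @IndepFun Ω Ω Γ mΩ m mΓ id Z P := by
    rw [← MeasurableSpace.comap_id (m := m)] at hind
    exact hind
  have hf : Measurable[m.prod mΓ] fun z : Ω × Γ => ENNReal.ofReal (h z.1 z.2) :=
    hmeas.ennreal_ofReal
  have heq := lintegral_comp_prodMk_of_indepFun (m𝓧 := m) (X := id) hX hZ hindF hf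
  have hmeas' : Measurable fun ω => h ω (Z ω) :=
    hmeas.comp (hX.prodMk hZ)
  have hR0 : ∀ ω, 0 ≤ R ω := fun ω => (integral_nonneg (hnn ω)).trans (hle ω)
  have hbound : ∫⁻ ω, ENNReal.ofReal (h ω (Z ω)) ∂P ≤ ENNReal.ofReal (∫ ω, R ω ∂P) := by
    rw [ofReal_integral_eq_lintegral_ofReal hR (Eventually.of_forall hR0)]
    refine heq.le.trans (lintegral_mono fun ω => ?_)
    change ∫⁻ y, ENNReal.ofReal (h ω y) ∂(P.map Z) ≤ _
    rw [← ofReal_integral_eq_lintegral_ofReal (hint ω) (Eventually.of_forall (hnn ω))]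
    exact ENNReal.ofReal_le_ofReal (hle ω)
  have hI : Integrable (fun ω => h ω (Z ω)) P := by
    refine ⟨hmeas'.aestronglyMeasurable, ?_⟩
    rw [hasFiniteIntegral_iff_ofReal (Eventually.of_forall fun ω => hnn _ _)]
    exact hbound.trans_lt ENNReal.ofReal_lt_top
  refine ⟨hI, ?_⟩
  rwa [← ofReal_integral_eq_lintegral_ofReal hI (Eventually.of_forall fun ω => hnn _ _),
    ENNReal.ofReal_le_ofReal_iff (integral_nonneg hR0)] at hbound

/-- A function of `(u, y)` that is continuous in `u` and strongly measurable in `y` may be composed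
with strongly measurable arguments; no separability is needed. -/
theorem stronglyMeasurable_comp_of_continuous_left {𝓧 U E : Type*} {m𝓧 : MeasurableSpace 𝓧}
    [TopologicalSpace U] [TopologicalSpace E] [TopologicalSpace.PseudoMetrizableSpace E]
    {G : U → Γ → E}
    (hc : ∀ y, Continuous fun u => G u y) (hG : ∀ u, StronglyMeasurable (G u))
    {f : 𝓧 → U} (hf : StronglyMeasurable f) {Z : 𝓧 → Γ} (hZ : Measurable Z) :
    StronglyMeasurable fun x => G (f x) (Z x) := by
  refine stronglyMeasurable_of_tendsto atTop (f := fun n x => G (hf.approx n x) (Z x))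
    (fun n => ⟨fun k => (hf.approx n).bind fun u => ((hG u).approx k).comp Z hZ, fun x => ?_⟩)
    (tendsto_pi_nhds.2 fun x => ((hc (Z x)).tendsto _).comp (hf.tendsto_approx x))
  exact (hG _).tendsto_approx (Z x)

end Freezing

/-! ### The iterates -/

section Iterates

variable {U Γ Ω : Type*} [NormedAddCommGroup U] [InnerProductSpace ℝ U] [CompleteSpace U]
  [MeasurableSpace Γ] {ρ : Measure Γ} {g : U → Γ → ℝ} {ℓ : Γ → ℝ} {ustar : U}
  {A : Params U Γ} {D : Draws Ω Γ} {u : ℤ → Ω → U} {𝓐 : MeasurableSpace Ω}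

/-- The coefficients of the control variate of iteration `k`. -/
def variateCoef (g : U → Γ → ℝ) (A : Params U Γ) (D : Draws Ω Γ) (u : ℤ → Ω → U) (k : ℕ) (ω : Ω) :
    Fin (A.dim k) → ℝ :=
  lsCoef A.φ (A.dim k) (A.weight k) (D.memory A k ω)
    fun l => gradCost g (u ((k : ℤ) - ((l : ℤ) + 1)) ω) (D.memory A k ω l)

theorem controlVariate_eq_expand (k : ℕ) (ω : Ω) :
    controlVariate g A D u k ω = expand A.φ (variateCoef g A D u k ω) :=
  condLeastSquares_eq_expand

theorem idealVariate_eq_expand (k : ℕ) (ω : Ω) :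
    idealVariate g A D ustar k ω = expand A.φ (variateCoef g A D (fun _ _ => ustar) k ω) :=
  condLeastSquares_eq_expand

theorem stronglyMeasurable_gradCost_comp {𝓧 : Type*} {m𝓧 : MeasurableSpace 𝓧}
    (hg : IsCost ρ g) (hℓ : LipschitzGradient ρ g ℓ) {e : 𝓧 → U} (he : StronglyMeasurable e)
    {Z : 𝓧 → Γ} (hZ : Measurable Z) : StronglyMeasurable fun x => gradCost g (e x) (Z x) :=
  stronglyMeasurable_comp_of_continuous_left hℓ.continuous_gradCost hg.grad_measurable he hZ

theorem stronglyMeasurable_step {𝓧 : Type*} {m𝓧 : MeasurableSpace 𝓧} [IsFiniteMeasure ρ]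
    (hg : IsCost ρ g) (hℓ : LipschitzGradient ρ g ℓ) {φ : ℕ → Γ → U} {n : ℕ}
    (hB : IsApproxBasis ρ φ n) {w : Γ → ℝ} (hw : Measurable w) {e : 𝓧 → U}
    (he : StronglyMeasurable e) {c : 𝓧 → Fin n → ℝ}
    (hc : ∀ j, StronglyMeasurable fun x => c x j) {Z : 𝓧 → Γ} (hZ : Measurable Z) (τ : ℝ) :
    StronglyMeasurable fun x => e x - τ • (w (Z x) • (gradCost g (e x) (Z x)
      - expand φ (c x) (Z x)) + ∫ y, expand φ (c x) y ∂ρ) :=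
  he.sub ((((hw.comp hZ).stronglyMeasurable.smul ((stronglyMeasurable_gradCost_comp hg hℓ he hZ).sub
    (stronglyMeasurable_expand_comp hB hc hZ))).add
    (stronglyMeasurable_integral_expand hB hc)).const_smul τ)

theorem stronglyMeasurable_variateCoef {m : MeasurableSpace Ω}
    (hg : IsCost ρ g) (hℓ : LipschitzGradient ρ g ℓ) (hA : A.IsAdmissible ρ)
    (hS : A.S.IsConsistent ρ) {k : ℕ}
    (hpt : ∀ i : ℤ, i < k → Measurable[m] (D.point A (A.phase k) i))
    (hu : ∀ i : ℤ, -(A.s 0 : ℤ) ≤ i → i < k → StronglyMeasurable[m] (u i)) (j : Fin (A.dim k)) :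
    StronglyMeasurable[m] fun ω => variateCoef g A D u k ω j := by
  have hmem : ∀ l : Fin (A.size k), Measurable[m] fun ω => D.memory A k ω l := fun l =>
    hpt _ (by omega)
  refine stronglyMeasurable_lsCoef (hA.basis _) (hS.weight _).measurable hmem (fun l => ?_) j
  have := hA.neg_size_le_sub k
  have hl := l.2
  exact stronglyMeasurable_gradCost_comp hg hℓ (hu _ (by omega) (by omega)) (hmem l)

variable [mΩ : MeasurableSpace Ω] {P : Measure Ω} [IsProbabilityMeasure P]

/-- A data point is independent of the iterate at which its gradient was evaluated, so the weighted
gradient error it stores is controlled by the error of that iterate. -/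
theorem Draws.IsSample.memory_error_le (hD : D.IsSample 𝓐 P A) (hA : A.IsAdmissible ρ)
    (hS : A.S.IsConsistent ρ) (hg : IsCost ρ g) (hℓ : LipschitzGradient ρ g ℓ) {k : ℕ}
    (l : Fin (A.size k)) {e : Ω → U}
    (he : StronglyMeasurable[D.past 𝓐 ((k : ℤ) - ((l : ℤ) + 1))] e) (he2 : MemLp e 2 P) (ustar : U) :
    Integrable (fun ω => A.weight k (D.memory A k ω l) *
      ‖gradCost g (e ω) (D.memory A k ω l) - gradCost g ustar (D.memory A k ω l)‖ ^ 2) P ∧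
    ∫ ω, A.weight k (D.memory A k ω l) *
      ‖gradCost g (e ω) (D.memory A k ω l) - gradCost g ustar (D.memory A k ω l)‖ ^ 2 ∂P ≤
      lipConst ρ ℓ ^ 2 * ∫ ω, ‖e ω - ustar‖ ^ 2 ∂P := by
  have hW := hS.weight (A.phase k)
  have hlaw := hD.map_memory hA hS k l
  have hI : ∀ ω, Integrable (fun y => ‖gradCost g (e ω) y - gradCost g ustar y‖ ^ 2) ρ := fun ω =>
    ((hg.grad_memLp _).sub (hg.grad_memLp _)).integrable_sq_norm
  rw [← integral_const_mul]
  refine integrable_and_integral_le_of_indep (hD.past_le ((k : ℤ) - ((l : ℤ) + 1)))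
    (hD.measurable_point (A.phase k) _) (hD.indep_past_point _ _)
    (h := fun ω y => A.weight k y * ‖gradCost g (e ω) y - gradCost g ustar y‖ ^ 2)
    ?_ (fun ω y => mul_nonneg (hW.nonneg y) (sq_nonneg _))
    ((he2.sub (memLp_const ustar)).integrable_sq_norm.const_mul _) (fun ω => ?_) (fun ω => ?_)
  · have h1 := stronglyMeasurable_gradCost_comp hg hℓ
      (he.comp_measurable (@measurable_fst _ _ (D.past 𝓐 ((k : ℤ) - ((l : ℤ) + 1))) _))
      (@measurable_snd _ _ (D.past 𝓐 ((k : ℤ) - ((l : ℤ) + 1))) _)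
    have h2 := (hg.grad_measurable ustar).comp_measurable
      (@measurable_snd _ _ (D.past 𝓐 ((k : ℤ) - ((l : ℤ) + 1))) _)
    have h3 := hW.measurable.comp (@measurable_snd _ _ (D.past 𝓐 ((k : ℤ) - ((l : ℤ) + 1))) _)
    exact h3.mul ((h1.sub h2).norm.pow 2).measurable
  · change Integrable _ (P.map fun ω => D.memory A k ω l)
    rw [hlaw]
    exact (hW.integrable_iff _).1 (hI ω)
  · change ∫ y, _ ∂(P.map fun ω => D.memory A k ω l) ≤ _
    rw [hlaw]
    exact ((hW.integral_eq _).symm.le).trans (hℓ.integral_sq_norm_sub_le hg (e ω) ustar)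

/-- The effect of the outdated iterates on the control variate. Its `L²_ρ` norm is the norm of the
coefficients, and least squares is linear in the data and stable. -/
theorem variateCoef_error_le (hD : D.IsSample 𝓐 P A) (hA : A.IsAdmissible ρ)
    (hS : A.S.IsConsistent ρ) (hg : IsCost ρ g) (hℓ : LipschitzGradient ρ g ℓ) {k : ℕ}
    (hu : ∀ i : ℤ, -(A.s 0 : ℤ) ≤ i → i < k → StronglyMeasurable[D.past 𝓐 i] (u i))
    (hu2 : ∀ i : ℤ, -(A.s 0 : ℤ) ≤ i → i < k → MemLp (u i) 2 P) (ustar : U) :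
    Integrable (fun ω => ∑ j, (variateCoef g A D u k ω j
      - variateCoef g A D (fun _ _ => ustar) k ω j) ^ 2) P ∧
    ∫ ω, ∑ j, (variateCoef g A D u k ω j - variateCoef g A D (fun _ _ => ustar) k ω j) ^ 2 ∂P ≤
      2 * ((1 / (A.size k : ℝ)) * ∑ l : Fin (A.size k), lipConst ρ ℓ ^ 2 *
        ∫ ω, ‖u ((k : ℤ) - ((l : ℤ) + 1)) ω - ustar‖ ^ 2 ∂P) := by
  have hsize := hA.neg_size_le_sub k
  have hdata := fun l : Fin (A.size k) => hD.memory_error_le hA hS hg hℓ l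
    (hu ((k : ℤ) - ((l : ℤ) + 1)) (by omega) (by omega)) (hu2 _ (by omega) (by omega)) ustar
  have hpt : ∀ i : ℤ, i < k → Measurable (D.point A (A.phase k) i) := fun i _ =>
    hD.measurable_point _ _
  have hc := stronglyMeasurable_variateCoef hg hℓ hA hS hpt
    fun i h1 h2 => (hu i h1 h2).mono (hD.past_le i)
  have hc' := stronglyMeasurable_variateCoef (u := fun _ _ => ustar) hg hℓ hA hS hpt
    fun i h1 h2 => stronglyMeasurable_const
  have hle : ∀ ω, ∑ j, (variateCoef g A D u k ω j
      - variateCoef g A D (fun _ _ => ustar) k ω j) ^ 2 ≤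
      2 * ((1 / (A.size k : ℝ)) * ∑ l : Fin (A.size k), A.weight k (D.memory A k ω l) *
        ‖gradCost g (u ((k : ℤ) - ((l : ℤ) + 1)) ω) (D.memory A k ω l)
          - gradCost g ustar (D.memory A k ω l)‖ ^ 2) := by
    intro ω
    refine le_trans (le_of_eq ?_) (sum_sq_lsCoef_le (φ := A.φ) (m := A.dim k)
      (hS.weight (A.phase k)).nonneg)
    rw [lsCoef_sub]
    rfl
  have hbI := ((integrable_finsetSum Finset.univ fun l _ => (hdata l).1).const_mul
    (1 / (A.size k : ℝ))).const_mul 2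
  have hI : Integrable (fun ω => ∑ j, (variateCoef g A D u k ω j
      - variateCoef g A D (fun _ _ => ustar) k ω j) ^ 2) P := by
    refine hbI.mono' (Finset.stronglyMeasurable_fun_sum _ fun j _ =>
      ((hc j).sub (hc' j)).pow 2).aestronglyMeasurable (Eventually.of_forall fun ω => ?_)
    rw [Real.norm_of_nonneg (Finset.sum_nonneg fun _ _ => sq_nonneg _)]
    exact hle ω
  refine ⟨hI, (integral_mono hI hbI hle).trans ?_⟩
  rw [integral_const_mul, integral_const_mul, integral_finsetSum _ fun l _ => (hdata l).1]
  gcongr with l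
  exact (hdata l).2

/-- The idealized control variate is square integrable, since its data `∇g(u*, Y_j)` are, with the
weight included. -/
theorem memLp_variateCoef_const (hD : D.IsSample 𝓐 P A) (hA : A.IsAdmissible ρ)
    (hS : A.S.IsConsistent ρ) (hg : IsCost ρ g) (hℓ : LipschitzGradient ρ g ℓ) (k : ℕ) (ustar : U)
    (j : Fin (A.dim k)) : MemLp (fun ω => variateCoef g A D (fun _ _ => ustar) k ω j) 2 P := by
  have hW := hS.weight (A.phase k)
  have hc := stronglyMeasurable_variateCoef (u := fun _ _ => ustar) hg hℓ hA hS
    (fun i (_ : i < (k : ℤ)) => hD.measurable_point (A.phase k) i)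
    (fun i _ _ => stronglyMeasurable_const) j
  have hdata : ∀ l : Fin (A.size k), Integrable (fun ω => A.weight k (D.memory A k ω l) *
      ‖gradCost g ustar (D.memory A k ω l)‖ ^ 2) P := by
    intro l
    have h1 := (hW.integrable_iff _).1 (hg.grad_memLp ustar).integrable_sq_norm
    rw [← hD.map_memory hA hS k l] at h1
    exact h1.comp_measurable (hD.measurable_point (A.phase k) _)
  have hbI := ((integrable_finsetSum Finset.univ fun l _ => hdata l).const_mul
    (1 / (A.size k : ℝ))).const_mul 2
  rw [memLp_two_iff_integrable_sq hc.aestronglyMeasurable]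
  refine hbI.mono' (hc.pow 2).aestronglyMeasurable (Eventually.of_forall fun ω => ?_)
  rw [Real.norm_of_nonneg (sq_nonneg _)]
  refine (Finset.single_le_sum (f := fun j => variateCoef g A D (fun _ _ => ustar) k ω j ^ 2)
    (fun _ _ => sq_nonneg _) (Finset.mem_univ j)).trans ?_
  exact sum_sq_lsCoef_le (φ := A.φ) (m := A.dim k) hW.nonneg

theorem integrable_idealVariate_error [IsProbabilityMeasure ρ] (hD : D.IsSample 𝓐 P A)
    (hA : A.IsAdmissible ρ) (hS : A.S.IsConsistent ρ) (hg : IsCost ρ g)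
    (hℓ : LipschitzGradient ρ g ℓ) (k : ℕ) (ustar : U) :
    Integrable (fun z : Ω × Γ =>
      ‖gradCost g ustar z.2 - idealVariate g A D ustar k z.1 z.2‖ ^ 2) (P.prod ρ) := by
  simp_rw [idealVariate_eq_expand]
  have hB := hA.basis (A.phase k)
  refine MemLp.integrable_sq_norm (MemLp.sub ((hg.grad_memLp ustar).comp_snd P) ?_)
  unfold expand
  refine memLp_finsetSum _ fun j _ => ?_
  have hc := memLp_variateCoef_const hD hA hS hg hℓ k ustar j
  have hm : AEStronglyMeasurable (fun z : Ω × Γ =>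
      variateCoef g A D (fun _ _ => ustar) k z.1 j • A.φ j z.2) (P.prod ρ) :=
    hc.1.comp_fst.smul (hB.memLp j j.2).1.comp_snd
  rw [memLp_two_iff_integrable_sq_norm hm]
  simp_rw [norm_smul, mul_pow]
  exact hc.integrable_sq_norm.mul_prod (hB.memLp j j.2).integrable_sq_norm

/-- One iteration: the draw `Y_k` is integrated out for a frozen past. The new iterate inherits
measurability and square integrability from the old ones. -/
theorem IsIterates.step_le [IsProbabilityMeasure ρ] {α : ℝ}
    (hu : IsIterates ρ g A 𝓐 P D u) (hD : D.IsSample 𝓐 P A)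
    (hA : A.IsAdmissible ρ) (hS : A.S.IsConsistent ρ) (hg : IsCost ρ g)
    (hα : StronglyConvex (objective ρ g) α)
    (hℓ : LipschitzGradient ρ g ℓ) (hustar : ∀ u, objective ρ g ustar ≤ objective ρ g u) {k : ℕ}
    (hum : ∀ i : ℤ, -(A.s 0 : ℤ) ≤ i → i ≤ k → StronglyMeasurable[D.past 𝓐 i] (u i))
    (hu2 : ∀ i : ℤ, -(A.s 0 : ℤ) ≤ i → i ≤ k → MemLp (u i) 2 P) :
    StronglyMeasurable[D.past 𝓐 ((k : ℤ) + 1)] (u ((k : ℤ) + 1)) ∧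
    MemLp (u ((k : ℤ) + 1)) 2 P ∧
    ∫ ω, ‖u ((k : ℤ) + 1) ω - ustar‖ ^ 2 ∂P ≤
      (1 - 2 * A.τ k * α + 4 * A.q k * A.τ k ^ 2 * lipConst ρ ℓ ^ 2) *
          ∫ ω, ‖u k ω - ustar‖ ^ 2 ∂P
        + 2 * A.q k * A.τ k ^ 2 *
          ∫ z : Ω × Γ, ‖gradCost g ustar z.2 - idealVariate g A D ustar k z.1 z.2‖ ^ 2 ∂(P.prod ρ)
        + 4 * A.q k * A.τ k ^ 2 * (2 * ((1 / (A.size k : ℝ)) * ∑ l : Fin (A.size k),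
          lipConst ρ ℓ ^ 2 * ∫ ω, ‖u ((k : ℤ) - ((l : ℤ) + 1)) ω - ustar‖ ^ 2 ∂P)) := by
  have hB : IsApproxBasis ρ A.φ (A.dim k) := hA.basis (A.phase k)
  have hW : IsWeight ρ (A.S.μ (A.phase k)) (A.weight k) (A.q k) := hS.weight (A.phase k)
  have hmk : D.past 𝓐 k ≤ mΩ := hD.past_le _
  have hmk1 : D.past 𝓐 ((k : ℤ) + 1) ≤ mΩ := hD.past_le _
  have hkk1 : D.past 𝓐 k ≤ D.past 𝓐 ((k : ℤ) + 1) := Draws.past_mono (by omega)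
  have hneg : -(A.s 0 : ℤ) ≤ k := by omega
  have hpt : ∀ i : ℤ, i < k → Measurable[D.past 𝓐 k] (D.point A (A.phase k) i) := fun i hi =>
    Draws.measurable_point_past hi
  have hc := stronglyMeasurable_variateCoef (m := D.past 𝓐 k) hg hℓ hA hS hpt
    fun i h1 h2 => (hum i h1 h2.le).mono (Draws.past_mono h2.le)
  -- The current draw is data point `k`, which has not met a switch yet.
  have hpoint : D.point A (A.phase k) (k : ℤ) = D.Y k :=
    Draws.point_eq_draw hA.sched_mono (by exact_mod_cast hA.sched_phase_le k)
  have hY1 : Measurable[D.past 𝓐 ((k : ℤ) + 1)] (D.Y k) := by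
    rw [← hpoint]
    exact Draws.measurable_point_past (by omega)
  have hstep : u ((k : ℤ) + 1) = fun ω => u k ω - A.τ k • (A.weight k (D.Y k ω) •
      (gradCost g (u k ω) (D.Y k ω) - expand A.φ (variateCoef g A D u k ω) (D.Y k ω))
        + ∫ y, expand A.φ (variateCoef g A D u k ω) y ∂ρ) := by
    ext ω
    rw [hu.step k ω, controlVariate_eq_expand]
  have hum1 : StronglyMeasurable[D.past 𝓐 ((k : ℤ) + 1)] (u ((k : ℤ) + 1)) := by
    rw [hstep]
    exact stronglyMeasurable_step hg hℓ hB hW.measurable ((hum k hneg le_rfl).mono hkk1)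
      (fun j => (hc j).mono hkk1) hY1 (A.τ k)
  have hcoef := variateCoef_error_le (u := u) hD hA hS hg hℓ (k := k)
    (fun i h1 h2 => hum i h1 h2.le) (fun i h1 h2 => hu2 i h1 h2.le) ustar
  have hideal := integrable_idealVariate_error (P := P) hD hA hS hg hℓ k ustar
  have he2 : MemLp (fun ω => u k ω - ustar) 2 P := (hu2 k hneg le_rfl).sub (memLp_const ustar)
  have : IsProbabilityMeasure (A.S.μ (A.phase k)) := by
    rw [← hD.law_Y k]
    exact Measure.isProbabilityMeasure_map (hD.measurable_Y k).aemeasurable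
  have hfrozen := fun ω => hW.step_le (hg.grad_measurable (u k ω)) (hg.grad_measurable ustar)
    (hB.stronglyMeasurable_expand (variateCoef g A D u k ω))
    (hB.stronglyMeasurable_expand (variateCoef g A D (fun _ _ => ustar) k ω))
    (hg.grad_memLp _) (hg.grad_memLp _) (hB.memLp_expand _) (hB.memLp_expand _)
    (integral_gradCost_minimizer hg hℓ hustar) (u k ω - ustar) (A.τ k)
  simp only [sub_right_comm _ ustar] at hfrozen
  have hi1 := he2.integrable_sq_norm.const_mul
    (1 - 2 * A.τ k * α + 4 * A.q k * A.τ k ^ 2 * lipConst ρ ℓ ^ 2)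
  have hi2 := hideal.integral_prod_left.const_mul (2 * A.q k * A.τ k ^ 2)
  have hi3 := hcoef.1.const_mul (4 * A.q k * A.τ k ^ 2)
  have hτ := hA.step_nonneg k
  have hq : 0 ≤ A.q k := Real.iSup_nonneg hW.nonneg
  have hfreeze := integrable_and_integral_le_of_indep hmk (hD.measurable_Y k)
    (by rw [← hpoint]; exact hD.indep_past_point _ _)
    (h := fun ω y => ‖u k ω - A.τ k • (A.weight k y • (gradCost g (u k ω) y
          - expand A.φ (variateCoef g A D u k ω) y)
          + ∫ x, expand A.φ (variateCoef g A D u k ω) x ∂ρ) - ustar‖ ^ 2)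
    ?_ (fun _ _ => sq_nonneg _) ((hi1.add hi2).add hi3) (fun ω => ?_) (fun ω => ?_)
  · have heq : ∀ ω, u k ω - A.τ k • (A.weight k (D.Y k ω) •
        (gradCost g (u k ω) (D.Y k ω) - expand A.φ (variateCoef g A D u k ω) (D.Y k ω))
        + ∫ x, expand A.φ (variateCoef g A D u k ω) x ∂ρ) = u ((k : ℤ) + 1) ω := fun ω => by
      rw [hstep]
    simp only [heq] at hfreeze
    refine ⟨hum1, ?_, hfreeze.2.trans ?_⟩
    · have h1 : MemLp (fun ω => u ((k : ℤ) + 1) ω - ustar) 2 P :=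
        (memLp_two_iff_integrable_sq_norm
          ((hum1.mono hmk1).sub stronglyMeasurable_const).aestronglyMeasurable).2 hfreeze.1
      have h2 := h1.add (memLp_const ustar)
      simp only [Pi.add_def, sub_add_cancel] at h2
      exact h2
    · simp only [Pi.add_apply]
      have hi12 := hi1.add hi2
      simp only [Pi.add_def] at hi12
      rw [integral_add hi12 hi3, integral_add hi1 hi2, integral_const_mul, integral_const_mul,
        integral_const_mul, integral_prod _ hideal]
      gcongr
      exact hcoef.2
  · have hfst := @measurable_fst Ω Γ (D.past 𝓐 k) inferInstance
    have hsnd := @measurable_snd Ω Γ (D.past 𝓐 k) inferInstance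
    exact ((stronglyMeasurable_step hg hℓ hB hW.measurable
      ((hum k hneg le_rfl).comp_measurable hfst) (fun j => (hc j).comp_measurable hfst) hsnd
      (A.τ k)).sub stronglyMeasurable_const).norm.measurable.pow_const 2
  · rw [hD.law_Y k]
    exact (hfrozen ω).1
  · rw [hD.law_Y k]
    refine (hfrozen ω).2.trans ?_
    have e1 := hα.le_inner_integral_gradCost hg hℓ hustar (u k ω)
    have e2 := hℓ.integral_sq_norm_sub_le hg (u k ω) ustar
    have e3 : ∫ y, ‖expand A.φ (variateCoef g A D u k ω) y
        - expand A.φ (variateCoef g A D (fun _ _ => ustar) k ω) y‖ ^ 2 ∂ρ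
        = ∑ j, (variateCoef g A D u k ω j - variateCoef g A D (fun _ _ => ustar) k ω j) ^ 2 := by
      simp_rw [← expand_sub]
      exact hB.integral_sq_norm_expand _
    simp only [Pi.add_apply, idealVariate_eq_expand]
    rw [e3]
    have e4 := mul_le_mul_of_nonneg_left e1 (mul_nonneg zero_le_two hτ)
    have e5 := mul_le_mul_of_nonneg_left e2
      (mul_nonneg (mul_nonneg zero_le_four hq) (sq_nonneg (A.τ k)))
    linarith

/-- The iterates are non-anticipating and square integrable: `u_i` is a function of the data points
older than `i`. -/
theorem IsIterates.stronglyMeasurable_and_memLp [IsProbabilityMeasure ρ] {α : ℝ}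
    (hu : IsIterates ρ g A 𝓐 P D u) (hD : D.IsSample 𝓐 P A)
    (hA : A.IsAdmissible ρ) (hS : A.S.IsConsistent ρ) (hg : IsCost ρ g)
    (hα : StronglyConvex (objective ρ g) α)
    (hℓ : LipschitzGradient ρ g ℓ) (hustar : ∀ u, objective ρ g ustar ≤ objective ρ g u) (k : ℕ) :
    ∀ i : ℤ, -(A.s 0 : ℤ) ≤ i → i ≤ k →
      StronglyMeasurable[D.past 𝓐 i] (u i) ∧ MemLp (u i) 2 P := by
  induction k with
  | zero =>
    intro i h1 h2
    refine ⟨(hu.init_adapted i h1 h2).mono (sup_le ?_ (iSup₂_le fun a ha => ?_)),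
      hu.init_memLp i h1 h2⟩
    · exact Draws.sigma_le_past (s := Source.init) trivial
    · exact Draws.sigma_le_past (s := Source.draw a) ha.2
  | succ k ih =>
    intro i h1 h2
    rcases (Int.le_iff_lt_or_eq.1 h2) with h | rfl
    · exact ih i h1 (by push_cast at h; omega)
    · have := hu.step_le hD hA hS hg hα hℓ hustar (k := k) (fun i a b => (ih i a b).1)
        (fun i a b => (ih i a b).2)
      push_cast
      exact ⟨this.1, this.2.1⟩

end Iterates

end SGLSCV

end

theorem mainTheorem4 {U Γ Ω : Type*}
    [NormedAddCommGroup U] [InnerProductSpace ℝ U] [CompleteSpace U]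
    [MeasurableSpace Γ] (ρ : Measure Γ) [IsProbabilityMeasure ρ]
    (𝓐 : MeasurableSpace Ω) [MeasurableSpace Ω] (P : Measure Ω) [IsProbabilityMeasure P]
    (g : U → Γ → ℝ) (hg : SGLSCV.IsCost ρ g)
    (α : ℝ) (hα : SGLSCV.StronglyConvex (SGLSCV.objective ρ g) α)
    (ℓ : Γ → ℝ) (hℓ : SGLSCV.LipschitzGradient ρ g ℓ)
    (ustar : U) (hustar : ∀ u, SGLSCV.objective ρ g ustar ≤ SGLSCV.objective ρ g u)
    (A : SGLSCV.Params U Γ) (hA : A.IsAdmissible ρ)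
    (D : SGLSCV.Draws Ω Γ) (hD : D.IsSample 𝓐 P A)
    (u : ℤ → Ω → U) (hu : SGLSCV.IsIterates ρ g A 𝓐 P D u) :
    (∀ j : ℤ, -(A.s 0 : ℤ) ≤ j → MemLp (u j) 2 P) ∧
    ∀ k : ℕ,
      -(A.s 0 : ℤ) ≤ (k : ℤ) - (A.size k : ℤ) ∧
      Integrable (fun z : Ω × Γ =>
        ‖SGLSCV.gradCost g ustar z.2 - SGLSCV.idealVariate g A D ustar k z.1 z.2‖ ^ 2)
        (P.prod ρ) ∧
      ∫ ω, ‖u ((k : ℤ) + 1) ω - ustar‖ ^ 2 ∂P ≤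
        (1 - 2 * A.τ k * α + 4 * A.q k * A.τ k ^ 2 * SGLSCV.lipConst ρ ℓ ^ 2) *
            ∫ ω, ‖u k ω - ustar‖ ^ 2 ∂P
          + 2 * A.q k * A.τ k ^ 2 *
            ∫ z : Ω × Γ,
              ‖SGLSCV.gradCost g ustar z.2 - SGLSCV.idealVariate g A D ustar k z.1 z.2‖ ^ 2
              ∂(P.prod ρ)
          + 24 * A.τ k ^ 2 * (A.q k / A.size k) *
            ∑ i ∈ Finset.Icc 1 (A.size k),
              SGLSCV.lipConst ρ ℓ ^ 2 * ∫ ω, ‖u ((k : ℤ) - (i : ℤ)) ω - ustar‖ ^ 2 ∂P := by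
  have : Nonempty Γ := nonempty_of_isProbabilityMeasure ρ
  have hS : A.S.IsConsistent ρ := hA.sampling.isConsistent hA.basis hA.nested hA.weight_bdd
  have hmem := hu.stronglyMeasurable_and_memLp hD hA hS hg hα hℓ hustar
  refine ⟨fun j hj => (hmem j.toNat j hj (Int.self_le_toNat j)).2, fun k =>
    ⟨hA.neg_size_le_sub k, SGLSCV.integrable_idealVariate_error hD hA hS hg hℓ k ustar, ?_⟩⟩
  refine (hu.step_le hD hA hS hg hα hℓ hustar (fun i h1 h2 => (hmem k i h1 h2).1)
    (fun i h1 h2 => (hmem k i h1 h2).2)).2.2.trans ?_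
  have hq : 0 ≤ A.q k := Real.iSup_nonneg (hS.weight (A.phase k)).nonneg
  have hsum : ∑ l : Fin (A.size k), SGLSCV.lipConst ρ ℓ ^ 2 *
      ∫ ω, ‖u ((k : ℤ) - ((l : ℤ) + 1)) ω - ustar‖ ^ 2 ∂P =
      ∑ i ∈ Finset.Icc 1 (A.size k), SGLSCV.lipConst ρ ℓ ^ 2 *
        ∫ ω, ‖u ((k : ℤ) - (i : ℤ)) ω - ustar‖ ^ 2 ∂P := by
    rw [Fin.sum_univ_eq_sum_range (fun l => SGLSCV.lipConst ρ ℓ ^ 2 *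
      ∫ ω, ‖u ((k : ℤ) - ((l : ℤ) + 1)) ω - ustar‖ ^ 2 ∂P), Finset.range_eq_Ico,
      ← Finset.Ico_add_one_right_eq_Icc, ← Finset.sum_Ico_add' _ 0 (A.size k) 1]
    push_cast
    rfl
  rw [hsum]
  have hnn : 0 ≤ ∑ i ∈ Finset.Icc 1 (A.size k), SGLSCV.lipConst ρ ℓ ^ 2 *
      ∫ ω, ‖u ((k : ℤ) - (i : ℤ)) ω - ustar‖ ^ 2 ∂P :=
    Finset.sum_nonneg fun i _ => mul_nonneg (sq_nonneg _) (integral_nonneg fun _ => sq_nonneg _)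
  have hpos : 0 ≤ A.τ k ^ 2 * (A.q k / A.size k) *
      ∑ i ∈ Finset.Icc 1 (A.size k), SGLSCV.lipConst ρ ℓ ^ 2 *
        ∫ ω, ‖u ((k : ℤ) - (i : ℤ)) ω - ustar‖ ^ 2 ∂P :=
    mul_nonneg (mul_nonneg (sq_nonneg _) (div_nonneg hq (Nat.cast_nonneg _))) hnn
  -- The estimate above gives the constant `8` in place of `24`.
  refine (add_le_add_right (le_of_eq ?_) _).trans (add_le_add_right
    (mul_le_mul_of_nonneg_right (by norm_num : (8 : ℝ) ≤ 24) hpos |>.trans (le_of_eq ?_)) _)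
  · ring
  · ring
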